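/- **Setting.** Let $\omega=e^{i\pi/3}$ and let $\Lambda=\mathbb Z+\mathbb Z\omega\subset\mathbb C$ be the triangular lattice. A *triangulation* of a region $\Omega\subseteq\mathbb C$ (for instance a polygon with lattice vertices) is a set of non-degenerate lattice triangles that cover $\Omega$, meet face to face, and use every lattice point of $\Omega$ as a vertex; it is *equilateral* if all its edges have the same length. A *flip* replaces, in a strictly convex quadrilateral formed by two triangles of a triangulation, the diagonal that is present with the other diagonal. A *flip path* from a triangulation is a finite sequence of flips that can be performed one after the other. It *generates* a set of edges if the last triangulation contains these edges. A *flip plan* that generates a set $E$ of edges from a triangulation $T$ is a finite partially ordered set $\pi$ of flips whose valid linear orderings are exactly the flip paths from $T$ that generate $E$ and whose set of flips is exactly $\pi$. An *edge* $e=(x,y)$ is a vector $xp+yq$ with $x,y\ge 0$ coprime integers, where $(p,q)$ is one of the three pairs $(1,\omega),(\omega,\omega^2),(\omega^2,\omega^3)$; the edge $e$ at a lattice point $v$ is the segment from $v$ to $v+e$. Put $\phi_e=x/y$ if $x<y$ and $\phi_e=y/x$ otherwise. A fraction $a/b$ in $[0,1]$ in lowest terms is turned back into an edge, written $\phi_e^{-1}(a/b)$,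 with the same pair $(p,q)$: it is $(a,b)$ if $x<y$, and $(b,a)$ otherwise. If $e$ is not a unit vector, its *Farey parallelogram* $P_{e,v}$ at $v$ has the diagonal $e$ at $v$ and has as sides copies of the two edges obtained in this way from the neighbors of $\phi_e$ in the first Farey sequence that contains $\phi_e$ (for $e=(1,1)$ the sides are $(0,1)$ and $(1,0)$). *Algorithm Farey Plan* returns the empty list for $(1,0)$ and $(0,1)$. Otherwise it starts with $d=\frac11$ and the sequence $X=(\frac01,\frac11)$, and records $d$; as long as $d\ne\phi_e$, it replaces $d$ by the mediant of $d$ and its successor in $X$ (if $d<\phi_e$) or its predecessor in $X$ (if $d>\phi_e$), inserts the new $d$ into $X$, and records it. The list of recorded fractions is the *Farey plan* $f_1,\dots,f_n$ of $e$. *Algorithm Flip Plan* on $e$ at $v$ with Farey plan $f_1,\dots,f_n$ returns a partially ordered set $\pi_{e,v}$ of flips. It is empty if $n=0$. If $n=1$ (that is, $e=(1,1)$), it is the single flip that creates $e$ in $P_{e,v}$. If $n\ge2$, it has as root the flip that creates $e$ in $P_{e,v}$, and the children of the root are the roots of the outputs on $e_1$ at $v$ and on $e_1$ at $v+e_2$,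 both with Farey plan $f_1,\dots,f_{n-1}$. Here $e_1=\phi_e^{-1}(f_{n-1})$ is the longer and $e_2$ is the shorter boundary edge of $P_{e,v}$. Equal flips are identified; descendants precede ancestors. For partially ordered sets $\pi,\pi'$ obtained in this way, $\pi\cup\pi'$ denotes their union with common flips identified. For $u\neq v$, the outputs $\pi_{e,u}$ and $\pi_{e,v}$ are *adjacent* if $e$ is not a unit vector and the root parallelograms $P_{e,u}$ and $P_{e,v}$ share a side. The edges $e$ at $u$ and $e$ at $v$ are *adjacent copies of $e$* in a triangulation if it contains both edges and, for each of $P_{e,u},P_{e,v}$, one of the two triangles into which $e$ cuts it, and these two triangles share an edge. **Theorem.** Let $T$ be an equilateral triangulation of a region $\Omega$, and let $e$ be an edge. 1. If $\pi_{e,u}$ and $\pi_{e,v}$ are adjacent outputs of Algorithm Flip Plan, and the edges $e$ at $u$ and $e$ at $v$ lie in $\Omega$, then $\pi_{e,u}\cup\pi_{e,v}$ is a flip plan that generates $e$ at $u$ and $e$ at $v$ from $T$. Moreover, in the triangulation obtained by performing any valid linear ordering of it, these are adjacent copies of $e$. 2. If the edge $e$ at $v$ lies in $\Omega$, then $\pi_{e,v}$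 is a flip plan that generates $e$ at $v$ from $T$: its valid linear orderings are exactly the flip paths from $T$ that generate $e$ at $v$ and whose set of flips is exactly $\pi_{e,v}$. -/

import Mathlib

namespace FareyFlip

/-! ### The triangular lattice -/

/-- A point of the triangular lattice, in coordinates with respect to two unit vectors that
make an angle of 60 degrees. -/
abbrev Pt : Type := ℤ × ℤ

/-- The position of a lattice point in the Euclidean plane `ℂ`: the lattice is `ℤ + ℤ ω` with
`ω = exp (i π / 3) = 1/2 + (√3/2) i`. -/
noncomputable def emb (p : Pt) : ℂ :=
  (p.1 : ℂ) + (p.2 : ℂ) * (⟨1 / 2, Real.sqrt 3 / 2⟩ : ℂ)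

/-- Anticlockwise rotation by 60 degrees (multiplication by `ω`, where `ω ^ 2 = ω - 1`). -/
def rot (p : Pt) : Pt := (-p.2, p.1 + p.2)

/-- The unit vector of the lattice at angle `60 k` degrees. -/
def unitVec (k : ℕ) : Pt := rot^[k] (1, 0)

/-! ### Triangulations -/

/-- The closed triangle spanned by a set of lattice points. -/
noncomputable def hull (t : Finset Pt) : Set ℂ := convexHull ℝ (emb '' (t : Set Pt))

/-- `T`, given by the vertex sets of its triangles, is a (lattice) triangulation of the region
`Ω`: non-degenerate lattice triangles that cover `Ω`, meet face to face, and use every lattice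
point of `Ω` as a vertex. -/
structure IsTriangulation (Ω : Set ℂ) (T : Set (Finset Pt)) : Prop where
  card_eq : ∀ t ∈ T, t.card = 3
  nondegenerate : ∀ t ∈ T, AffineIndependent ℝ (fun p : t => emb p)
  cover : (⋃ t ∈ T, hull t) = Ω
  face_to_face : ∀ t ∈ T, ∀ t' ∈ T, hull t ∩ hull t' = hull (t ∩ t')
  uses_all : ∀ p : Pt, emb p ∈ Ω → ∃ t ∈ T, p ∈ t

/-- The edges of a collection of triangles. -/
def edges (T : Set (Finset Pt)) : Set (Sym2 Pt) :=
  {s | ∃ a b : Pt, a ≠ b ∧ s = s(a, b) ∧ ∃ t ∈ T, a ∈ t ∧ b ∈ t}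

/-- A triangulation of `Ω` all of whose edges have the same length. -/
structure IsEquilateralTriangulation (Ω : Set ℂ) (T : Set (Finset Pt)) : Prop
    extends IsTriangulation Ω T where
  equal_length : ∀ a b c d : Pt, s(a, b) ∈ edges T → s(c, d) ∈ edges T →
    dist (emb a) (emb b) = dist (emb c) (emb d)

/-! ### Flips and flip paths -/

/-- A flip on a quadrilateral: the diagonal `old` is replaced with the diagonal `new`. -/
structure Flip where
  old : Sym2 Pt
  new : Sym2 Pt
deriving DecidableEq

/-- The flip `s` can be performed in `T` and yields `T'`. The quadrilateral `a b c d` consists of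
the triangles `a b c` and `a c d` of `T`; it is (strictly) convex, that is, its diagonals cross
in a relatively interior point of both. If `T` is a triangulation of a region, then so is `T'`, since
the same convex quadrilateral is covered. -/
def Performs (T : Set (Finset Pt)) (s : Flip) (T' : Set (Finset Pt)) : Prop :=
  ∃ a b c d : Pt, s.old = s(a, c) ∧ s.new = s(b, d) ∧
    ({a, b, c} : Finset Pt) ∈ T ∧ ({a, c, d} : Finset Pt) ∈ T ∧
    (openSegment ℝ (emb a) (emb c) ∩ openSegment ℝ (emb b) (emb d)).Nonempty ∧
    T' = (T \ {({a, b, c} : Finset Pt), ({a, c, d} : Finset Pt)}) ∪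
      {({a, b, d} : Finset Pt), ({b, c, d} : Finset Pt)}

/-- `FlipPath T l T'`: the flips of `l` can be performed one after the other, starting from `T`,
and the result is `T'`. -/
inductive FlipPath : Set (Finset Pt) → List Flip → Set (Finset Pt) → Prop
  | nil (T : Set (Finset Pt)) : FlipPath T [] T
  | cons {T T₁ T' : Set (Finset Pt)} {s : Flip} {l : List Flip}
      (h : Performs T s T₁) (hl : FlipPath T₁ l T') : FlipPath T (s :: l) T'

/-! ### Partially ordered sets of flips and flip plans -/

/-- A finite set of flips with parent-child arcs; `(s, t) ∈ child` says that `t` is a child of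
`s`. -/
structure FlipPoset where
  flips : Finset Flip
  child : Finset (Flip × Flip)

/-- `D.Below t s`: `t` is strictly below `s`, i.e. a descendant of `s`; `t` must be performed
before `s`. -/
def FlipPoset.Below (D : FlipPoset) (t s : Flip) : Prop :=
  Relation.TransGen (fun x y => (y, x) ∈ D.child) t s

/-- The union of two partially ordered sets of flips; common flips are merged. -/
def FlipPoset.union (D D' : FlipPoset) : FlipPoset :=
  ⟨D.flips ∪ D'.flips, D.child ∪ D'.child⟩

/-- `l` lists every flip of `D` exactly once, in an order compatible with that of `D`. -/
def FlipPoset.IsLinearOrdering (D : FlipPoset) (l : List Flip) : Prop :=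
  l.Nodup ∧ (∀ s, s ∈ l ↔ s ∈ D.flips) ∧ l.Pairwise (fun s t => ¬ D.Below t s)

/-- `D` is a flip plan that generates the set of edges `E` from the triangulation `T`: `D` is
partially ordered (has no directed cycle), and its valid linear orderings are exactly the flip
paths that start in `T`, end in a triangulation containing `E`, and consist of exactly the flips
in `D`. -/
def IsFlipPlan (D : FlipPoset) (T : Set (Finset Pt)) (E : Set (Sym2 Pt)) : Prop :=
  (∀ s, ¬ D.Below s s) ∧
  ∀ l : List Flip, D.IsLinearOrdering l ↔
    (∃ T', FlipPath T l T' ∧ E ⊆ edges T') ∧ ∀ s, s ∈ l ↔ s ∈ D.flips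

/-! ### Edges and Farey sequences -/

/-- An edge (up to translation): coprime nonnegative coordinates `(x, y)` with respect to its
defining coordinate pair. The three pairs are `(unitVec k, unitVec (k + 1))`, `k = 0, 1, 2`;
nonnegative coordinates mean that the edge lies in the 60 degree sector of the pair, and this is
the pair for which `|x| + |y|` is minimal. -/
structure Edge where
  pair : Fin 3
  x : ℕ
  y : ℕ
  coprime : Nat.Coprime x y

/-- The lattice vector of an edge. -/
def Edge.vec (e : Edge) : Pt :=
  (e.x : ℤ) • unitVec e.pair + (e.y : ℤ) • unitVec (e.pair + 1 : ℕ)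

/-- The edge `e` at the point `v`, as an (unoriented) pair of lattice points. -/
def Edge.at (e : Edge) (v : Pt) : Sym2 Pt := s(v, v + e.vec)

/-- The edge `e` at the point `v`, as a segment in the plane. -/
noncomputable def Edge.seg (e : Edge) (v : Pt) : Set ℂ := segment ℝ (emb v) (emb (v + e.vec))

/-- The Farey sequence of order `n`: all fractions in `[0, 1]` with denominator at most `n`, in
increasing order. -/
def fareySeq (n : ℕ) : List ℚ :=
  (((Finset.range (n + 1) ×ˢ Finset.Icc 1 n).filter (fun p => p.1 ≤ p.2)).image
    (fun p => (p.1 : ℚ) / (p.2 : ℚ))).sort (· ≤ ·)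

/-- The term directly before `d` in the increasing sequence `X`. -/
def before (X : List ℚ) (d : ℚ) : ℚ := (X.filter (fun q => q < d)).getLastD 0

/-- The term directly after `d` in the increasing sequence `X`. -/
def after (X : List ℚ) (d : ℚ) : ℚ := (X.filter (fun q => d < q)).headD 1

/-- The mediant of two reduced fractions. -/
def mediant (q r : ℚ) : ℚ := ((q.num + r.num : ℤ) : ℚ) / ((q.den + r.den : ℕ) : ℚ)

/-- The Farey-flip map: `x / y` if `x < y`, and `y / x` otherwise. -/
def Edge.phi (e : Edge) : ℚ := if e.x < e.y then (e.x : ℚ) / e.y else (e.y : ℚ) / e.x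

/-- The inverse Farey-flip map selected by `e`: it keeps the defining coordinate pair of `e` and
the order of the coordinates. -/
def Edge.phiInv (e : Edge) (f : ℚ) : Edge :=
  if e.x < e.y then ⟨e.pair, f.num.natAbs, f.den, f.reduced⟩
  else ⟨e.pair, f.den, f.num.natAbs, Nat.Coprime.symm f.reduced⟩

/-- The two boundary edges of the Farey parallelogram of `e`: the Farey neighbor edges of `e` in
the first Farey sequence that contains `e`, and `(0, 1)`, `(1, 0)` if `e` is the edge `(1, 1)`. -/
def Edge.neighbors (e : Edge) : Edge × Edge :=
  if e.x = 1 ∧ e.y = 1 then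
    (⟨e.pair, 0, 1, Nat.coprime_one_right 0⟩, ⟨e.pair, 1, 0, Nat.coprime_one_left 0⟩)
  else
    (e.phiInv (before (fareySeq e.phi.den) e.phi), e.phiInv (after (fareySeq e.phi.den) e.phi))

/-- The squared Euclidean length of `e`, by the law of cosines in the triangular lattice. -/
def Edge.sqLength (e : Edge) : ℕ := e.x ^ 2 + e.x * e.y + e.y ^ 2

/-- The shorter boundary edge of the Farey parallelogram of `e`. -/
def Edge.shorterNeighbor (e : Edge) : Edge :=
  if e.neighbors.1.sqLength ≤ e.neighbors.2.sqLength then e.neighbors.1 else e.neighbors.2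

/-- The four sides of the Farey parallelogram of `e` at `v`. -/
def Edge.sides (e : Edge) (v : Pt) : Finset (Sym2 Pt) :=
  {s(v, v + e.neighbors.1.vec), s(v, v + e.neighbors.2.vec),
    s(v + e.neighbors.1.vec, v + e.vec), s(v + e.neighbors.2.vec, v + e.vec)}

/-- The flip on the Farey parallelogram of `e` at `v`: it replaces the other diagonal with `e`. -/
def Edge.flip (e : Edge) (v : Pt) : Flip :=
  ⟨s(v + e.neighbors.1.vec, v + e.neighbors.2.vec), e.at v⟩

/-- The two halves into which the edge `e` cuts its Farey parallelogram at `v`. -/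
def Edge.halves (e : Edge) (v : Pt) : Finset (Finset Pt) :=
  {{v, v + e.neighbors.1.vec, v + e.vec}, {v, v + e.neighbors.2.vec, v + e.vec}}

/-! ### The algorithms -/

/-- The loop of Algorithm Farey Plan with target fraction `f`, current sequence `X` and current
fraction `d`. The first argument bounds the number of iterations. -/
def fareyLoop (f : ℚ) : ℕ → List ℚ → ℚ → List ℚ
  | 0, _, _ => []
  | n + 1, X, d =>
    if d = f then [d]
    else
      let d' := if d < f then mediant d (after X d) else mediant d (before X d)
      d :: fareyLoop f n (X.orderedInsert (· ≤ ·) d') d'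

/-- Algorithm Farey Plan. The denominator of the target fraction is a sufficient number of
iterations, since the denominators of the fractions produced increase strictly. -/
def Edge.fareyPlan (e : Edge) : List ℚ :=
  if (e.x = 0 ∧ e.y = 1) ∨ (e.x = 1 ∧ e.y = 0) then []
  else fareyLoop e.phi e.phi.den (fareySeq 1) 1

/-- Algorithm Flip Plan on the edge `e` at the point `v`; the first argument is the Farey plan of
`e`, last fraction first. The longer boundary edge of the Farey parallelogram is obtained from
the last fraction but one. Flips and arcs form sets, so duplicate flips are consolidated. -/
def flipPlanAux : List ℚ → Edge → Pt → FlipPoset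
  | [], _, _ => ⟨∅, ∅⟩
  | [_], e, v => ⟨{e.flip v}, ∅⟩
  | _ :: g :: C, e, v =>
    let e₁ := e.phiInv g
    let w := v + e.shorterNeighbor.vec
    let D := flipPlanAux (g :: C) e₁ v
    let D' := flipPlanAux (g :: C) e₁ w
    ⟨{e.flip v} ∪ (D.flips ∪ D'.flips),
      {(e.flip v, e₁.flip v), (e.flip v, e₁.flip w)} ∪ (D.child ∪ D'.child)⟩

/-- The output of Algorithm Flip Plan on the edge `e` at the point `v` and its Farey plan. -/
def Edge.flipPlan (e : Edge) (v : Pt) : FlipPoset := flipPlanAux e.fareyPlan.reverse e v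

/-! ### Adjacency -/

/-- The outputs of Algorithm Flip Plan on `e` at `u` and on `e` at `v` are adjacent: they have
root flips (`e` is not a unit edge), and their two root parallelograms, which are different,
share a side. -/
def AdjacentPlans (e : Edge) (u v : Pt) : Prop :=
  e.fareyPlan ≠ [] ∧ u ≠ v ∧ (e.sides u ∩ e.sides v).Nonempty

/-- In `T` the edges `e` at `u` and `e` at `v` are adjacent copies of `e`: both edges and one
half of each of their Farey parallelograms exist in `T`, and these halves share an edge. -/
def AdjacentCopies (T : Set (Finset Pt)) (e : Edge) (u v : Pt) : Prop :=
  u ≠ v ∧ e.at u ∈ edges T ∧ e.at v ∈ edges T ∧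
    ∃ t ∈ e.halves u, ∃ t' ∈ e.halves v, t ∈ T ∧ t' ∈ T ∧ (t ∩ t').card = 2

end FareyFlip

namespace FareyFlip

/-! ### Flip posets as marked graphs -/

/-! A flip consumes two triangles and creates two others. The central point is that the flips of a
plan form a marked graph in the sense of Petri nets: each triangle is consumed by at most one flip
and created by at most one, created triangles are not in the initial triangulation, and the arcs
join each consumer to the producer of a triangle that it needs. For such a system the order of
execution is forced exactly up to the partial order. A compatible order always finds its triangles
ready (`flipPath_prefix`). Conversely, a path with the right set of flips cannot perform a flip
before its descendants (`below_mem_prefix`), nor perform a flip twice (`not_twice`, by descent in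
the rank).

The marked graph comes from mediants. Starting from two unit vectors `P`, `Q` at 60 degrees, a
branch of the Stern–Brocot tree is a list of steps `L`, and `basis P Q L` spans the Farey
parallelogram of the edge `tip P Q L`. The old diagonal of a parallelogram cuts it into one created
half of each of its two children (`inp_cons`). Uniqueness of producers and consumers follows from
the linear functional `height`, equal to 1 on `P` and `Q`: it orders the vertices of a created
triangle, so that the triangle determines its flip within a branch (`out_eq`). Initial triangles
have height spread at most 1, created ones at least 2.

At the bottom of the plan, the triangles must really be in `T`. An equilateral triangulation
consists of unit triangles, since a larger equilateral lattice triangle contains a lattice point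
that is not one of its vertices. The old diagonal of every bottom rhombus is crossed by the edge to
be generated (`Node.crossing`), so that this edge passes through the interior of both halves of the
rhombus; as the edge lies in the region, both halves belong to `T` (`inp_mem_of_crossing`).

Finally the algorithms, stated with rational numbers and sorted lists, are shown to follow this
branch (`fareyLoop_eq`, `Edge.IsTip.flipPlanAux`). The union of two plans is treated by the same
argument, with the union of the two sets of nodes. -/

/-- The two triangles that the flip `s` removes. -/
def Flip.pre (s : Flip) : Set (Finset Pt) := {τ | ∃ b ∈ s.new, τ = insert b s.old.toFinset}

/-- The two triangles that the flip `s` creates. -/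
def Flip.post (s : Flip) : Set (Finset Pt) := {τ | ∃ a ∈ s.old, τ = insert a s.new.toFinset}

/-- The diagonals of the quadrilateral of `s` cross. -/
def Flip.Crossing (s : Flip) : Prop :=
  ∃ a b c d : Pt, s.old = s(a, c) ∧ s.new = s(b, d) ∧
    (openSegment ℝ (emb a) (emb c) ∩ openSegment ℝ (emb b) (emb d)).Nonempty

theorem Flip.pre_mk (a b c d : Pt) : (Flip.mk s(a, c) s(b, d)).pre = {{a, b, c}, {a, c, d}} := by
  have h1 : insert b (s(a, c) : Sym2 Pt).toFinset = {a, b, c} := by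
    ext; simp; tauto
  have h2 : insert d (s(a, c) : Sym2 Pt).toFinset = {a, c, d} := by
    ext; simp; tauto
  ext τ
  simp only [Flip.pre, Set.mem_ofPred_eq, Sym2.mem_iff, Set.mem_insert_iff, Set.mem_singleton_iff]
  constructor
  · rintro ⟨x, rfl | rfl, rfl⟩
    · exact Or.inl h1
    · exact Or.inr h2
  · rintro (rfl | rfl)
    · exact ⟨b, Or.inl rfl, h1.symm⟩
    · exact ⟨d, Or.inr rfl, h2.symm⟩

theorem Flip.post_mk (a b c d : Pt) : (Flip.mk s(a, c) s(b, d)).post = {{a, b, d}, {b, c, d}} := by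
  have h1 : insert a (s(b, d) : Sym2 Pt).toFinset = {a, b, d} := by
    ext; simp
  have h2 : insert c (s(b, d) : Sym2 Pt).toFinset = {b, c, d} := by
    ext; simp; tauto
  ext τ
  simp only [Flip.post, Set.mem_ofPred_eq, Sym2.mem_iff, Set.mem_insert_iff, Set.mem_singleton_iff]
  constructor
  · rintro ⟨x, rfl | rfl, rfl⟩
    · exact Or.inl h1
    · exact Or.inr h2
  · rintro (rfl | rfl)
    · exact ⟨a, Or.inl rfl, h1.symm⟩
    · exact ⟨c, Or.inr rfl, h2.symm⟩

/-- The two triangle sets depend only on the unordered diagonals, so the labels of the quadrilateral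
disappear and a flip becomes a move of tokens. -/
theorem performs_iff {T T' : Set (Finset Pt)} {s : Flip} :
    Performs T s T' ↔ s.Crossing ∧ s.pre ⊆ T ∧ T' = (T \ s.pre) ∪ s.post := by
  obtain ⟨old, new⟩ := s
  constructor
  · rintro ⟨a, b, c, d, h1, h2, h3, h4, h5, h6⟩
    simp only at h1 h2
    subst h1 h2
    refine ⟨⟨a, b, c, d, rfl, rfl, h5⟩, ?_, ?_⟩
    · rw [Flip.pre_mk]
      rintro _ (rfl | rfl)
      exacts [h3, h4]
    · rw [Flip.pre_mk, Flip.post_mk, h6]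
  · rintro ⟨⟨a, b, c, d, h1, h2, h5⟩, h, h6⟩
    simp only at h1 h2
    subst h1 h2
    rw [Flip.pre_mk] at h
    rw [Flip.pre_mk, Flip.post_mk] at h6
    exact ⟨a, b, c, d, rfl, rfl, h (by simp), h (by simp), h5, h6⟩

/-! ### Elementary facts about flip paths -/

theorem FlipPath.unique {T T₁ T₂ : Set (Finset Pt)} {l : List Flip} (h₁ : FlipPath T l T₁)
    (h₂ : FlipPath T l T₂) : T₁ = T₂ := by
  induction h₁ with
  | nil => cases h₂; rfl
  | cons h _ ih =>
    cases h₂ with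
    | cons h' hl' =>
      rw [performs_iff] at h h'
      obtain rfl := h.2.2.trans h'.2.2.symm
      exact ih hl'

theorem flipPath_append {T T' : Set (Finset Pt)} {l m : List Flip} :
    FlipPath T (l ++ m) T' ↔ ∃ T₁, FlipPath T l T₁ ∧ FlipPath T₁ m T' := by
  induction l generalizing T with
  | nil =>
    refine ⟨fun h => ⟨T, .nil T, h⟩, ?_⟩
    rintro ⟨_, h, h'⟩
    cases h
    exact h'
  | cons s l ih =>
    constructor
    · intro h
      cases h with
      | cons h hl =>
        obtain ⟨T₂, h2, h3⟩ := ih.1 hl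
        exact ⟨T₂, .cons h h2, h3⟩
    · rintro ⟨T₂, h, h'⟩
      cases h with
      | cons h hl => exact .cons h (ih.2 ⟨_, hl, h'⟩)

theorem flipPath_cons {T T' : Set (Finset Pt)} {s : Flip} {l : List Flip} :
    FlipPath T (s :: l) T' ↔ ∃ T₁, Performs T s T₁ ∧ FlipPath T₁ l T' := by
  constructor
  · intro h
    cases h with
    | cons h hl => exact ⟨_, h, hl⟩
  · rintro ⟨_, h, hl⟩
    exact .cons h hl

/-- A triangle that is present at the end of a flip path was present at the beginning or is
created on the way. -/
theorem FlipPath.mem_or_post {T T' : Set (Finset Pt)} {l : List Flip} (h : FlipPath T l T')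
    {τ : Finset Pt} (hτ : τ ∈ T') : τ ∈ T ∨ ∃ s ∈ l, τ ∈ s.post := by
  induction h with
  | nil => exact Or.inl hτ
  | cons h _ ih =>
    rw [performs_iff] at h
    rcases ih hτ with h1 | ⟨s, hs, h1⟩
    · rw [h.2.2] at h1
      rcases h1 with h1 | h1
      · exact Or.inl h1.1
      · exact Or.inr ⟨_, by simp, h1⟩
    · exact Or.inr ⟨s, by simp [hs], h1⟩

/-- In `D`, every triangle has at most one producer and at most one consumer, and the arcs of `D`
lead from the consumer of a triangle to its producer. -/
structure FlipPoset.IsMarkedGraph (D : FlipPoset) (T : Set (Finset Pt)) (rank : Flip → ℕ) :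
    Prop where
  crossing : ∀ s ∈ D.flips, s.Crossing
  pre_inj : ∀ s ∈ D.flips, ∀ t ∈ D.flips, ∀ τ, τ ∈ s.pre → τ ∈ t.pre → s = t
  post_inj : ∀ s ∈ D.flips, ∀ t ∈ D.flips, ∀ τ, τ ∈ s.post → τ ∈ t.post → s = t
  post_not_mem : ∀ s ∈ D.flips, ∀ τ ∈ s.post, τ ∉ T
  pre_mem : ∀ s ∈ D.flips, ∀ τ ∈ s.pre, τ ∈ T ∨ ∃ c, (s, c) ∈ D.child ∧ τ ∈ c.post
  child_mem : ∀ s c, (s, c) ∈ D.child → s ∈ D.flips ∧ c ∈ D.flips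
  child_rank : ∀ s c, (s, c) ∈ D.child → rank c < rank s
  child_post : ∀ s c, (s, c) ∈ D.child → ∃ τ ∈ s.pre, τ ∈ c.post

namespace FlipPoset.IsMarkedGraph

variable {D : FlipPoset} {T : Set (Finset Pt)} {rank : Flip → ℕ}

theorem rank_lt (h : D.IsMarkedGraph T rank) {s t : Flip} (hst : D.Below t s) :
    rank t < rank s := by
  induction hst with
  | single h1 => exact h.child_rank _ _ h1
  | tail _ h1 ih => exact ih.trans (h.child_rank _ _ h1)

theorem below_irrefl (h : D.IsMarkedGraph T rank) (s : Flip) : ¬ D.Below s s :=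
  fun h1 => lt_irrefl _ (h.rank_lt h1)

/-- A created triangle is not initial, so its consumer receives it from some child; by uniqueness of
producers that child is `s`. -/
theorem child_of_post_pre (h : D.IsMarkedGraph T rank) {s t : Flip} (hs : s ∈ D.flips)
    (ht : t ∈ D.flips) {τ : Finset Pt} (h1 : τ ∈ s.post) (h2 : τ ∈ t.pre) :
    (t, s) ∈ D.child := by
  rcases h.pre_mem t ht τ h2 with h3 | ⟨c, hc, h3⟩
  · exact absurd h3 (h.post_not_mem s hs τ h1)
  · rwa [h.post_inj s hs c (h.child_mem _ _ hc).2 τ h1 h3]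

/-- The triangles present after the flips of `l`. -/
def state (T : Set (Finset Pt)) (l : List Flip) : Set (Finset Pt) :=
  {τ | (τ ∈ T ∨ ∃ s ∈ l, τ ∈ s.post) ∧ ∀ s ∈ l, τ ∉ s.pre}

/-- Induction on prefixes of a fixed ordering, because a proper prefix is not itself a linear
ordering of `D`. -/
theorem flipPath_prefix (h : D.IsMarkedGraph T rank) {l : List Flip}
    (hl : D.IsLinearOrdering l) (m : List Flip) (hm : m <+: l) : FlipPath T m (state T m) := by
  induction m using List.reverseRecOn with
  | nil =>
    have : state T [] = T := by ext; simp [state]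
    rw [this]
    exact .nil T
  | append_singleton m s ih =>
    obtain ⟨r, rfl⟩ := hm
    have ih := ih ⟨s :: r, by simp⟩
    obtain ⟨hnd, hmem, hpw⟩ := hl
    rw [List.append_assoc, List.singleton_append] at hnd hmem hpw
    have hsD : s ∈ D.flips := (hmem s).1 (by simp)
    have hmD : ∀ t ∈ m, t ∈ D.flips := fun t ht => (hmem t).1 (by simp [ht])
    rw [List.pairwise_append] at hpw
    rw [List.nodup_append] at hnd
    have hbefore : ∀ t ∈ m, ¬ D.Below s t := fun t ht => hpw.2.2 t ht s (by simp)
    have hafter : ∀ t ∈ r, ¬ D.Below t s := (List.pairwise_cons.1 hpw.2.1).1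
    have hne : ∀ t ∈ m, t ≠ s := fun t ht => hnd.2.2 t ht s (by simp)
    rw [flipPath_append]
    refine ⟨_, ih, flipPath_cons.2 ⟨_, ?_, .nil _⟩⟩
    rw [performs_iff]
    refine ⟨h.crossing s hsD, ?_, ?_⟩
    -- An input triangle is initial or made by a child of `s`, and compatibility with the order puts
    -- that child into `m`. No flip of `m` has removed it, since `s` is its only consumer.
    · intro τ hτ
      refine ⟨?_, fun t ht h1 => hne t ht (h.pre_inj t (hmD t ht) s hsD τ h1 hτ)⟩
      rcases h.pre_mem s hsD τ hτ with h1 | ⟨c, hc, h1⟩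
      · exact Or.inl h1
      · refine Or.inr ⟨c, ?_, h1⟩
        have hcl := (hmem c).2 (h.child_mem _ _ hc).2
        have hb : D.Below c s := .single hc
        rcases List.mem_append.1 hcl with h2 | h2
        · exact h2
        · rcases List.mem_cons.1 h2 with rfl | h2
          · exact absurd hb (h.below_irrefl c)
          · exact absurd hb (hafter c h2)
    · ext τ
      constructor
      · rintro ⟨h1, h2⟩
        by_cases hp : τ ∈ s.post
        · exact Or.inr hp
        refine Or.inl ⟨⟨?_, fun t ht => h2 t (by simp [ht])⟩, h2 s (by simp)⟩
        rcases h1 with h1 | ⟨t, ht, h1⟩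
        · exact Or.inl h1
        · rcases List.mem_append.1 ht with ht | ht
          · exact Or.inr ⟨t, ht, h1⟩
          · rw [List.mem_singleton.1 ht] at h1
            exact absurd h1 hp
      · rintro (⟨⟨h1, h2⟩, h3⟩ | h1)
        · refine ⟨h1.imp id fun ⟨t, ht, h4⟩ => ⟨t, by simp [ht], h4⟩, fun t ht => ?_⟩
          rcases List.mem_append.1 ht with ht | ht
          · exact h2 t ht
          · rwa [List.mem_singleton.1 ht]
        -- A flip that had already consumed this new triangle would be a parent of `s` listed no
        -- later than `s`.
        · refine ⟨Or.inr ⟨s, by simp, h1⟩, fun t ht h2 => ?_⟩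
          rcases List.mem_append.1 ht with ht | ht
          · exact hbefore t ht (.single (h.child_of_post_pre hsD (hmD t ht) h1 h2))
          · rw [List.mem_singleton.1 ht] at h2
            exact h.below_irrefl s (.single (h.child_of_post_pre hsD hsD h1 h2))

theorem flipPath (h : D.IsMarkedGraph T rank) {l : List Flip} (hl : D.IsLinearOrdering l) :
    FlipPath T l (state T l) := h.flipPath_prefix hl l List.prefix_rfl

/-- A created triangle that no flip consumes is present at the end. -/
theorem mem_of_post (h : D.IsMarkedGraph T rank) {l : List Flip} (hl : D.IsLinearOrdering l)
    {T' : Set (Finset Pt)} (hT' : FlipPath T l T') {s : Flip} (hs : s ∈ D.flips)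
    (htop : ∀ t, (t, s) ∉ D.child) {τ : Finset Pt} (hτ : τ ∈ s.post) : τ ∈ T' := by
  rw [hT'.unique (h.flipPath hl)]
  refine ⟨Or.inr ⟨s, (hl.2.1 s).2 hs, hτ⟩, fun t ht h1 => htop t ?_⟩
  exact h.child_of_post_pre hs ((hl.2.1 t).1 ht) hτ h1

/-- The triangle that `s` takes from `c` is absent at the start and has no other producer, so `c`
must have been performed. -/
theorem child_mem_prefix (h : D.IsMarkedGraph T rank) {T' : Set (Finset Pt)} {l m : List Flip}
    {s c : Flip} (hp : FlipPath T (l ++ s :: m) T') (hD : ∀ t ∈ l, t ∈ D.flips)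
    (hc : (s, c) ∈ D.child) : c ∈ l := by
  obtain ⟨T₁, h1, h2⟩ := flipPath_append.1 hp
  obtain ⟨T₂, h2, -⟩ := flipPath_cons.1 h2
  rw [performs_iff] at h2
  obtain ⟨τ, h3, h4⟩ := h.child_post _ _ hc
  have hcD := (h.child_mem _ _ hc).2
  rcases h1.mem_or_post (h2.2.1 h3) with h5 | ⟨t, ht, h5⟩
  · exact absurd h5 (h.post_not_mem c hcD τ h4)
  · rwa [h.post_inj c hcD t (hD t ht) τ h4 h5]

/-- The prefix is quantified after the relation because the induction passes to the shorter prefix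
that ends at an intermediate flip. -/
theorem below_mem_prefix (h : D.IsMarkedGraph T rank) {T' : Set (Finset Pt)} {s t : Flip}
    (hst : D.Below t s) : ∀ {l m : List Flip}, FlipPath T (l ++ s :: m) T' →
      (∀ t ∈ l, t ∈ D.flips) → t ∈ l := by
  induction hst with
  | single h1 => exact fun hp hD => h.child_mem_prefix hp hD h1
  | tail _ h1 ih =>
    intro l m hp hD
    obtain ⟨l₁, l₂, rfl⟩ := List.append_of_mem (h.child_mem_prefix hp hD h1)
    rw [List.append_assoc, List.cons_append] at hp
    have := ih hp fun t ht => hD t (by simp [ht])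
    simp [this]

theorem pre_nonempty (s : Flip) : s.pre.Nonempty := by
  obtain ⟨old, new⟩ := s
  induction new with
  | _ b d => exact ⟨_, b, by simp, rfl⟩

/-- A second `s` needs its input triangle again, so a flip `c` has recreated it between the two
occurrences. This `c` is a child of `s`, hence it also occurs before the first `s`; so `c` occurs
twice as well, at smaller rank. -/
theorem not_twice (h : D.IsMarkedGraph T rank) {T' : Set (Finset Pt)} (n : ℕ) :
    ∀ {s : Flip} {l m r : List Flip}, rank s < n → FlipPath T (l ++ s :: (m ++ s :: r)) T' →
      (∀ t ∈ l ++ s :: (m ++ s :: r), t ∈ D.flips) → False := by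
  induction n with
  | zero => intro s l m r hs; omega
  | succ n ih =>
    intro s l m r hs hp hD
    have hsD : s ∈ D.flips := hD s (by simp)
    obtain ⟨T₁, h1, h2⟩ := flipPath_append.1 hp
    obtain ⟨T₂, h2, h3⟩ := flipPath_cons.1 h2
    obtain ⟨T₃, h3, h4⟩ := flipPath_append.1 h3
    obtain ⟨T₄, h4, -⟩ := flipPath_cons.1 h4
    rw [performs_iff] at h2 h4
    obtain ⟨τ, hτ⟩ := pre_nonempty s
    have hτ2 : τ ∉ T₂ := by
      rw [h2.2.2]
      rintro (h5 | h5)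
      · exact h5.2 hτ
      · exact h.below_irrefl s (.single (h.child_of_post_pre hsD hsD h5 hτ))
    rcases h3.mem_or_post (h4.2.1 hτ) with h5 | ⟨c, hc, h5⟩
    · exact hτ2 h5
    have hcD : c ∈ D.flips := hD c (by simp [hc])
    have hcs := h.child_of_post_pre hcD hsD h5 hτ
    have hcl := h.child_mem_prefix hp (fun t ht => hD t (by simp [ht])) hcs
    obtain ⟨l₁, l₂, rfl⟩ := List.append_of_mem hcl
    obtain ⟨m₁, m₂, rfl⟩ := List.append_of_mem hc
    have e : (l₁ ++ c :: l₂) ++ s :: ((m₁ ++ c :: m₂) ++ s :: r) =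
        l₁ ++ c :: ((l₂ ++ s :: m₁) ++ c :: (m₂ ++ s :: r)) := by simp
    rw [e] at hp hD
    exact ih (by have := h.child_rank _ _ hcs; omega) hp hD

/-- A list with the same set of flips could a priori repeat some of them; `not_twice` excludes this
and `below_mem_prefix` gives the order. -/
theorem isLinearOrdering (h : D.IsMarkedGraph T rank) {T' : Set (Finset Pt)} {l : List Flip}
    (hp : FlipPath T l T') (hl : ∀ s, s ∈ l ↔ s ∈ D.flips) : D.IsLinearOrdering l := by
  have hnd : l.Nodup := by
    rw [List.nodup_iff_sublist]
    intro s hs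
    obtain ⟨l₁, l₂, rfl, hs1, h2⟩ := List.cons_sublist_iff.1 hs
    obtain ⟨l₃, l₄, rfl⟩ := List.append_of_mem (List.singleton_sublist.1 h2)
    obtain ⟨l₅, l₆, rfl⟩ := List.append_of_mem hs1
    have e : (l₅ ++ s :: l₆) ++ (l₃ ++ s :: l₄) = l₅ ++ s :: ((l₆ ++ l₃) ++ s :: l₄) := by simp
    rw [e] at hp hl
    exact h.not_twice _ (Nat.lt_succ_self _) hp fun t ht => (hl t).1 ht
  refine ⟨hnd, hl, List.pairwise_iff_forall_sublist.2 ?_⟩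
  intro s t hst hb
  obtain ⟨l₁, l₂, rfl, h1, h2⟩ := List.cons_sublist_iff.1 hst
  obtain ⟨l₅, l₆, rfl⟩ := List.append_of_mem h1
  have e : (l₅ ++ s :: l₆) ++ l₂ = l₅ ++ s :: (l₆ ++ l₂) := by simp
  rw [e] at hp hl hnd
  have := h.below_mem_prefix hb hp fun t ht => (hl t).1 (by simp [ht])
  rw [List.nodup_append] at hnd
  exact hnd.2.2 t this t (by simp [List.singleton_sublist.1 h2]) rfl

theorem isFlipPlan (h : D.IsMarkedGraph T rank) {E : Set (Sym2 Pt)}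
    (hE : ∀ l T', D.IsLinearOrdering l → FlipPath T l T' → E ⊆ edges T') : IsFlipPlan D T E :=
  ⟨h.below_irrefl, fun _ => ⟨fun hl => ⟨⟨_, h.flipPath hl, hE _ _ hl (h.flipPath hl)⟩, hl.2.1⟩,
    fun ⟨⟨_, hp, _⟩, hl⟩ => h.isLinearOrdering hp hl⟩⟩

end FlipPoset.IsMarkedGraph

/-! ### Bases reached by mediant steps -/

section Basis

variable {M : Type*} [AddCommMonoid M]

/-- The basis reached from `(A, B)` by the mediant steps of a list, last step first: the mediant
`A + B` replaces the second (`true`) or the first (`false`) basis vector. -/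
def basis (P Q : M) : List Bool → M × M
  | [] => (P, Q)
  | true :: L => ((basis P Q L).1, (basis P Q L).1 + (basis P Q L).2)
  | false :: L => ((basis P Q L).1 + (basis P Q L).2, (basis P Q L).2)

/-- The mediant of the basis reached by a list of steps. -/
def tip (P Q : M) (L : List Bool) : M := (basis P Q L).1 + (basis P Q L).2

/-- The basis vector that a step keeps. -/
def pivot (P Q : M) : Bool → List Bool → M
  | true, L => (basis P Q L).1
  | false, L => (basis P Q L).2

theorem tip_cons (P Q : M) (t : Bool) (L : List Bool) :
    tip P Q (t :: L) = tip P Q L + pivot P Q t L := by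
  cases t
  · simp only [tip, basis, pivot]
  · simp only [tip, basis, pivot, add_comm]

/-- Mediant steps use only addition. This carries statements about fractions, as pairs in `ℕ × ℕ`,
over to lattice vectors. -/
theorem map_basis {N : Type*} [AddCommMonoid N] (f : M →+ N) (P Q : M) (L : List Bool) :
    basis (f P) (f Q) L = (f (basis P Q L).1, f (basis P Q L).2) := by
  induction L with
  | nil => rfl
  | cons t L ih => cases t <;> simp [basis, ih]

end Basis

/-! ### Flips on parallelograms -/

/-- The flip on the parallelogram at `u` spanned by the basis reached by `L`. -/
def pflip (P Q : Pt) (L : List Bool) (u : Pt) : Flip :=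
  ⟨s(u + (basis P Q L).1, u + (basis P Q L).2), s(u, u + tip P Q L)⟩

/-- The triangles removed by `pflip`. -/
def inp (P Q : Pt) (L : List Bool) (u : Pt) : Bool → Finset Pt
  | true => {u, u + (basis P Q L).1, u + (basis P Q L).2}
  | false => {u + (basis P Q L).1, u + (basis P Q L).2, u + tip P Q L}

/-- The triangles created by `pflip`. -/
def out (P Q : Pt) (L : List Bool) (u : Pt) : Bool → Finset Pt
  | true => {u, u + (basis P Q L).1, u + tip P Q L}
  | false => {u, u + (basis P Q L).2, u + tip P Q L}

theorem mem_pre_pflip {P Q : Pt} {L : List Bool} {u : Pt} {τ : Finset Pt} :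
    τ ∈ (pflip P Q L u).pre ↔ ∃ i, τ = inp P Q L u i := by
  rw [pflip, Flip.pre_mk, Bool.exists_bool, or_comm]
  simp only [inp, Set.mem_insert_iff, Set.mem_singleton_iff]
  rw [Finset.insert_comm]

theorem mem_post_pflip {P Q : Pt} {L : List Bool} {u : Pt} {τ : Finset Pt} :
    τ ∈ (pflip P Q L u).post ↔ ∃ i, τ = out P Q L u i := by
  rw [pflip, Flip.post_mk, Bool.exists_bool, or_comm]
  simp only [out, Set.mem_insert_iff, Set.mem_singleton_iff]
  rw [Finset.insert_comm]

/-- The geometric core: the old diagonal of the parallelogram at `t :: L` is a translate of the edge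
`tip P Q L`' s other neighbor, a copy of `tip - pivot` in the new basis, and it cuts off one created
half of the child at `u` and one of the child at `u + pivot`. A `false` step exchanges the labels of
the halves. -/
theorem inp_cons (P Q : Pt) (t : Bool) (L : List Bool) (u : Pt) (i : Bool) :
    inp P Q (t :: L) u i =
      out P Q L (if i then u else u + pivot P Q t L) (if t then i else !i) := by
  cases t <;> cases i <;> simp only [inp, out, tip, pivot, basis, if_true, Bool.not_true,
    Bool.not_false, Bool.false_eq_true, if_false, add_assoc] <;> ext x <;>
    simp only [Finset.mem_insert, Finset.mem_singleton]
  · rw [add_comm (basis P Q L).2 (basis P Q L).1, add_comm (basis P Q L).2 (_ + _), add_assoc]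
    tauto
  · tauto

theorem emb_add (p q : Pt) : emb (p + q) = emb p + emb q := by
  simp only [emb, Prod.fst_add, Prod.snd_add, Int.cast_add]
  ring

/-- The diagonals of a parallelogram bisect each other. -/
theorem crossing_pflip (P Q : Pt) (L : List Bool) (u : Pt) : (pflip P Q L u).Crossing := by
  refine ⟨_, _, _, _, rfl, rfl, midpoint ℝ (emb (u + (basis P Q L).1)) (emb (u + (basis P Q L).2)),
    ?_, ?_⟩
  · exact ⟨1 / 2, 1 / 2, by norm_num, by norm_num, by norm_num, by
      rw [midpoint_eq_smul_add, smul_add]; norm_num⟩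
  · refine ⟨1 / 2, 1 / 2, by norm_num, by norm_num, by norm_num, ?_⟩
    rw [midpoint_eq_smul_add, tip]
    simp only [emb_add, Complex.real_smul, invOf_eq_inv]
    push_cast
    ring

/-! ### Frames -/

/-- The determinant of two lattice vectors. -/
def cr (a b : Pt) : ℤ := a.1 * b.2 - a.2 * b.1

/-- The linear functional that is `1` on `P` and on `Q`. -/
def height (P Q z : Pt) : ℤ := cr P Q * (cr z Q + cr P z)

/-- `P` and `Q` form a basis of the lattice. -/
def IsFrame (P Q : Pt) : Prop := cr P Q * cr P Q = 1

theorem height_add (P Q a b : Pt) : height P Q (a + b) = height P Q a + height P Q b := by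
  simp only [height, cr, Prod.fst_add, Prod.snd_add]
  ring

namespace IsFrame

variable {P Q : Pt} (h : IsFrame P Q)

include h

theorem height_left : height P Q P = 1 := by
  unfold IsFrame at h; simp only [height, cr] at h ⊢; linarith

theorem height_right : height P Q Q = 1 := by
  unfold IsFrame at h; simp only [height, cr] at h ⊢; linarith

theorem height_basis_pos (L : List Bool) :
    0 < height P Q (basis P Q L).1 ∧ 0 < height P Q (basis P Q L).2 := by
  induction L with
  | nil => simp [basis, h.height_left, h.height_right]
  | cons t L ih => cases t <;> simp only [basis, height_add] <;> omega

theorem height_tip (L : List Bool) : 2 ≤ height P Q (tip P Q L) := by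
  have := h.height_basis_pos L
  rw [tip, height_add]
  omega

omit h in
theorem cr_basis (L : List Bool) : cr (basis P Q L).1 (basis P Q L).2 = cr P Q := by
  induction L with
  | nil => rfl
  | cons t L ih =>
    rw [← ih]
    cases t <;> simp only [basis, cr, Prod.fst_add, Prod.snd_add] <;> ring

/-- Mediant steps preserve the determinant, which a swap would negate. This keeps the two halves of
parallelograms apart in `out_eq`. -/
theorem basis_ne_swap (L L' : List Bool) : basis P Q L ≠ (basis P Q L').swap := by
  intro h1
  have h2 := cr_basis (P := P) (Q := Q) L
  have h3 := cr_basis (P := P) (Q := Q) L'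
  rw [h1] at h2
  have h4 : cr (basis P Q L').swap.1 (basis P Q L').swap.2 = - cr P Q := by
    rw [← h3]; simp only [cr, Prod.fst_swap, Prod.snd_swap]; ring
  have h5 : cr P Q = 0 := by omega
  unfold IsFrame at h
  simp [h5] at h

/-- Each step adds a pivot of positive height to the tip. Height therefore serves as rank, and it
separates the nodes of one branch. -/
theorem height_tip_lt {L L' : List Bool} (hs : L <:+ L') (hne : L ≠ L') :
    height P Q (tip P Q L) < height P Q (tip P Q L') := by
  obtain ⟨m, rfl⟩ := hs
  have key : ∀ m : List Bool, height P Q (tip P Q L) + m.length ≤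
      height P Q (tip P Q (m ++ L)) := by
    intro m
    induction m with
    | nil => simp
    | cons t m ih =>
      rw [List.cons_append, tip_cons, height_add]
      have := h.height_basis_pos (m ++ L)
      cases t <;> simp only [pivot, List.length_cons] <;> push_cast <;> omega
  have := key m
  cases m with
  | nil => simp at hne
  | cons t m => simp only [List.length_cons] at this; push_cast at this; omega

theorem suffix_eq_of_tip {L₁ L₂ L : List Bool} (h₁ : L₁ <:+ L) (h₂ : L₂ <:+ L)
    (ht : tip P Q L₁ = tip P Q L₂) : L₁ = L₂ := by
  by_contra hne
  rcases List.suffix_or_suffix_of_suffix h₁ h₂ with h3 | h3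
  · exact (h.height_tip_lt h3 hne).ne (by rw [ht])
  · exact (h.height_tip_lt h3 (Ne.symm hne)).ne (by rw [ht])

end IsFrame

theorem sorted_triple_eq {α : Type*} [DecidableEq α] (f : α → ℤ) {x y z x' y' z' : α}
    (h : ({x, y, z} : Finset α) = {x', y', z'}) (h₁ : f x < f y) (h₂ : f y < f z)
    (h₃ : f x' < f y') (h₄ : f y' < f z') : x = x' ∧ y = y' ∧ z = z' := by
  have hx : x ∈ ({x', y', z'} : Finset α) := by rw [← h]; simp
  have hy : y ∈ ({x', y', z'} : Finset α) := by rw [← h]; simp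
  have hz : z ∈ ({x', y', z'} : Finset α) := by rw [← h]; simp
  simp only [Finset.mem_insert, Finset.mem_singleton] at hx hy hz
  have e : ∀ {a b : α}, a = b → f a = f b := fun h => by rw [h]
  rcases hx with hx | hx | hx <;> rcases hy with hy | hy | hy <;> rcases hz with hz | hz | hz <;>
    first
    | exact ⟨hx, hy, hz⟩
    | (have := e hx; have := e hy; have := e hz; omega)

namespace IsFrame

variable {P Q : Pt} (h : IsFrame P Q)

include h

/-- The vertices of a created triangle, in the order of their heights. -/
theorem out_eq (L L' : List Bool) {u u' : Pt} {i i' : Bool}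
    (ho : out P Q L u i = out P Q L' u' i') :
    u = u' ∧ i = i' ∧ tip P Q L = tip P Q L' := by
  have p1 := h.height_basis_pos L
  have p2 := h.height_basis_pos L'
  -- Heights increase strictly along `u`, `u + a`, `u + (a + b)`, so the set determines `u`, and
  -- then `a` and `b` as successive differences.
  have key : ∀ {a b a' b' : Pt}, ({u, u + a, u + (a + b)} : Finset Pt) =
      {u', u' + a', u' + (a' + b')} → 0 < height P Q a → 0 < height P Q b →
      0 < height P Q a' → 0 < height P Q b' → u = u' ∧ (a, b) = (a', b') := by
    intro a b a' b' h1 h2 h3 h4 h5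
    obtain ⟨rfl, h6, h7⟩ := sorted_triple_eq (height P Q) h1 (by rw [height_add]; omega)
      (by simp only [height_add]; omega) (by rw [height_add]; omega)
      (by simp only [height_add]; omega)
    obtain rfl := add_left_cancel h6
    obtain rfl := add_left_cancel (add_left_cancel h7)
    exact ⟨rfl, rfl⟩
  cases i <;> cases i' <;> simp only [out, tip] at ho
  · rw [add_comm (basis P Q L).1, add_comm (basis P Q L').1] at ho
    obtain ⟨h1, h2⟩ := key ho p1.2 p1.1 p2.2 p2.1
    simp only [Prod.mk.injEq] at h2
    exact ⟨h1, rfl, by rw [tip, tip, h2.1, h2.2]⟩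
  · rw [add_comm (basis P Q L).1] at ho
    obtain ⟨h1, h2⟩ := key ho p1.2 p1.1 p2.1 p2.2
    exact absurd (congrArg Prod.swap h2) (h.basis_ne_swap L L')
  · rw [add_comm (basis P Q L').1] at ho
    obtain ⟨h1, h2⟩ := key ho p1.1 p1.2 p2.2 p2.1
    exact absurd h2 (h.basis_ne_swap L L')
  · obtain ⟨h1, h2⟩ := key ho p1.1 p1.2 p2.1 p2.2
    simp only [Prod.mk.injEq] at h2
    exact ⟨h1, rfl, by rw [tip, tip, h2.1, h2.2]⟩

/-- One kind of unit triangle has a single lowest vertex and the other a single highest one, which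
rules out mixed cases; the single vertex then determines the position. -/
theorem inp_nil_eq {u u' : Pt} {i i' : Bool} (ho : inp P Q [] u i = inp P Q [] u' i') :
    u = u' := by
  have hP := h.height_left
  have hQ := h.height_right
  have hne : P ≠ Q := by
    rintro rfl
    unfold IsFrame at h
    simp [cr, mul_comm] at h
  have e : ∀ {a b : Pt}, a = b → height P Q a = height P Q b := fun h => by rw [h]
  have key : ∀ {u u' : Pt}, inp P Q [] u true = inp P Q [] u' false → False := by
    intro u u' ho
    have h1 : u ∈ inp P Q [] u' false := by rw [← ho]; simp [inp]
    have h2 : u + P ∈ inp P Q [] u' false := by rw [← ho]; simp [inp, basis]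
    have h3 : u + Q ∈ inp P Q [] u' false := by rw [← ho]; simp [inp, basis]
    simp only [inp, tip, basis, Finset.mem_insert, Finset.mem_singleton] at h1 h2 h3
    have hne' : u + P ≠ u + Q := fun h => hne (add_left_cancel h)
    rcases h2 with h2 | h2 | h2
    · have := e h2
      rcases h1 with h1 | h1 | h1 <;> have := e h1 <;> simp only [height_add] at * <;> omega
    · have := e h2
      rcases h1 with h1 | h1 | h1 <;> have := e h1 <;> simp only [height_add] at * <;> omega
    · rcases h3 with h3 | h3 | h3
      · have := e h3
        rcases h1 with h1 | h1 | h1 <;> have := e h1 <;> simp only [height_add] at * <;> omega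
      · have := e h3
        rcases h1 with h1 | h1 | h1 <;> have := e h1 <;> simp only [height_add] at * <;> omega
      · exact hne' (h2.trans h3.symm)
  cases i <;> cases i'
  · have h1 : u + (P + Q) ∈ inp P Q [] u' false := by rw [← ho]; simp [inp, basis, tip]
    have h2 : u' + (P + Q) ∈ inp P Q [] u false := by rw [ho]; simp [inp, basis, tip]
    simp only [inp, tip, basis, Finset.mem_insert, Finset.mem_singleton] at h1 h2
    rcases h1 with h1 | h1 | h1 <;> rcases h2 with h2 | h2 | h2 <;> first
      | exact add_right_cancel h1
      | exact (add_right_cancel h2).symm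
      | (have := e h1; have := e h2; simp only [height_add] at *; omega)
  · exact (key ho.symm).elim
  · exact (key ho).elim
  · have h1 : u ∈ inp P Q [] u' true := by rw [← ho]; simp [inp, basis]
    have h2 : u' ∈ inp P Q [] u true := by rw [ho]; simp [inp, basis]
    simp only [inp, basis, Finset.mem_insert, Finset.mem_singleton] at h1 h2
    rcases h1 with h1 | h1 | h1 <;> rcases h2 with h2 | h2 | h2 <;> first
      | exact h1
      | exact h2.symm
      | (have := e h1; have := e h2; simp only [height_add] at *; omega)

end IsFrame

/-! ### The nodes of a plan -/

/-- `Node P Q L v L' u`: the flip `pflip P Q L' u` is a descendant of `pflip P Q L v`. -/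
inductive Node (P Q : Pt) (L : List Bool) (v : Pt) : List Bool → Pt → Prop
  | root : Node P Q L v L v
  | left {t : Bool} {L' : List Bool} {u : Pt} (h : Node P Q L v (t :: L') u) : Node P Q L v L' u
  | right {t : Bool} {L' : List Bool} {u : Pt} (h : Node P Q L v (t :: L') u) :
      Node P Q L v L' (u + pivot P Q t L')

theorem Node.suffix {P Q : Pt} {L L' : List Bool} {v u : Pt} (h : Node P Q L v L' u) :
    L' <:+ L := by
  induction h with
  | root => exact List.suffix_rfl
  | left _ ih => exact (List.suffix_cons _ _).trans ih
  | right _ ih => exact (List.suffix_cons _ _).trans ih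

/-- `Node` grows at its lower end while `plan` recurses from the root; this reconciles the two. -/
theorem node_cons {P Q : Pt} {t : Bool} {L L' : List Bool} {v u : Pt} :
    Node P Q (t :: L) v L' u ↔ (L' = t :: L ∧ u = v) ∨ Node P Q L v L' u ∨
      Node P Q L (v + pivot P Q t L) L' u := by
  constructor
  · intro h
    induction h with
    | root => exact Or.inl ⟨rfl, rfl⟩
    | left _ ih =>
      rcases ih with ⟨h1, rfl⟩ | h1 | h1
      · cases h1
        exact Or.inr (Or.inl .root)
      · exact Or.inr (Or.inl h1.left)
      · exact Or.inr (Or.inr h1.left)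
    | right _ ih =>
      rcases ih with ⟨h1, rfl⟩ | h1 | h1
      · cases h1
        exact Or.inr (Or.inr .root)
      · exact Or.inr (Or.inl h1.right)
      · exact Or.inr (Or.inr h1.right)
  · rintro (⟨rfl, rfl⟩ | h | h)
    · exact .root
    · induction h with
      | root => exact .left .root
      | left _ ih => exact ih.left
      | right _ ih => exact ih.right
    · induction h with
      | root => exact .right .root
      | left _ ih => exact ih.left
      | right _ ih => exact ih.right

/-- The partially ordered set of flips that leads to `pflip P Q L v`. -/
def plan (P Q : Pt) : List Bool → Pt → FlipPoset
  | [], v => ⟨{pflip P Q [] v}, ∅⟩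
  | t :: L, v =>
    ⟨{pflip P Q (t :: L) v} ∪ ((plan P Q L v).flips ∪ (plan P Q L (v + pivot P Q t L)).flips),
      {(pflip P Q (t :: L) v, pflip P Q L v),
        (pflip P Q (t :: L) v, pflip P Q L (v + pivot P Q t L))} ∪
        ((plan P Q L v).child ∪ (plan P Q L (v + pivot P Q t L)).child)⟩

/-- `D` consists of the flips at the nodes in `K`. -/
structure FlipPoset.HasNodes (D : FlipPoset) (P Q : Pt) (K : List Bool → Pt → Prop) : Prop where
  flips : ∀ s, s ∈ D.flips ↔ ∃ L u, K L u ∧ s = pflip P Q L u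
  child : ∀ s c, (s, c) ∈ D.child ↔ ∃ t L u, K (t :: L) u ∧ s = pflip P Q (t :: L) u ∧
    (c = pflip P Q L u ∨ c = pflip P Q L (u + pivot P Q t L))

/-- Different descents may reach the same flip. Describing the plan by its set of nodes makes the
identification of equal flips automatic. -/
theorem hasNodes_plan (P Q : Pt) (L : List Bool) (v : Pt) :
    (plan P Q L v).HasNodes P Q (Node P Q L v) := by
  induction L generalizing v with
  | nil =>
    have hn : ∀ L u, Node P Q [] v L u → L = [] ∧ u = v := by
      intro L u h
      induction h with
      | root => exact ⟨rfl, rfl⟩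
      | left _ ih => simp at ih
      | right _ ih => simp at ih
    constructor
    · intro s
      simp only [plan, Finset.mem_singleton]
      constructor
      · rintro rfl
        exact ⟨_, _, .root, rfl⟩
      · rintro ⟨L, u, h, rfl⟩
        obtain ⟨rfl, rfl⟩ := hn _ _ h
        rfl
    · intro s c
      simp only [plan, Finset.notMem_empty, false_iff]
      rintro ⟨t, L, u, h, -⟩
      simpa using (hn _ _ h).1
  | cons t L ih =>
    constructor
    · intro s
      simp only [plan, Finset.mem_union, Finset.mem_singleton, (ih _).flips, node_cons]
      constructor
      · rintro (rfl | ⟨L', u, h, rfl⟩ | ⟨L', u, h, rfl⟩)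
        · exact ⟨_, _, Or.inl ⟨rfl, rfl⟩, rfl⟩
        · exact ⟨_, _, Or.inr (Or.inl h), rfl⟩
        · exact ⟨_, _, Or.inr (Or.inr h), rfl⟩
      · rintro ⟨L', u, ⟨rfl, rfl⟩ | h | h, rfl⟩
        · exact Or.inl rfl
        · exact Or.inr (Or.inl ⟨_, _, h, rfl⟩)
        · exact Or.inr (Or.inr ⟨_, _, h, rfl⟩)
    · intro s c
      simp only [plan, Finset.mem_union, Finset.mem_insert, Finset.mem_singleton, (ih _).child,
        node_cons, Prod.mk.injEq]
      constructor
      · rintro ((⟨rfl, rfl⟩ | ⟨rfl, rfl⟩) | ⟨t', L', u, h, rfl, h'⟩ | ⟨t', L', u, h, rfl, h'⟩)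
        · exact ⟨_, _, _, Or.inl ⟨rfl, rfl⟩, rfl, Or.inl rfl⟩
        · exact ⟨_, _, _, Or.inl ⟨rfl, rfl⟩, rfl, Or.inr rfl⟩
        · exact ⟨_, _, _, Or.inr (Or.inl h), rfl, h'⟩
        · exact ⟨_, _, _, Or.inr (Or.inr h), rfl, h'⟩
      · rintro ⟨t', L', u, ⟨h, rfl⟩ | h | h, rfl, h'⟩
        · cases h
          exact Or.inl (h'.imp (fun h => ⟨rfl, h⟩) fun h => ⟨rfl, h⟩)
        · exact Or.inr (Or.inl ⟨_, _, _, h, rfl, h'⟩)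
        · exact Or.inr (Or.inr ⟨_, _, _, h, rfl, h'⟩)

theorem FlipPoset.HasNodes.union {D D' : FlipPoset} {P Q : Pt} {K K' : List Bool → Pt → Prop}
    (h : D.HasNodes P Q K) (h' : D'.HasNodes P Q K') :
    (D.union D').HasNodes P Q (fun L u => K L u ∨ K' L u) := by
  constructor
  · intro s
    simp only [FlipPoset.union, Finset.mem_union, h.flips, h'.flips, or_and_right, exists_or]
  · intro s c
    simp only [FlipPoset.union, Finset.mem_union, h.child, h'.child, or_and_right, exists_or]

/-- The height difference of the edge that a flip creates. -/
def Flip.rank (P Q : Pt) (s : Flip) : ℕ :=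
  Sym2.lift ⟨fun a b => (height P Q a - height P Q b).natAbs, fun a b => by
    simp only; omega⟩ s.new

namespace IsFrame

variable {P Q : Pt} (h : IsFrame P Q)

include h

theorem rank_pflip (L : List Bool) (u : Pt) :
    ((pflip P Q L u).rank P Q : ℤ) = height P Q (tip P Q L) := by
  have h1 := h.height_tip L
  have h2 : (pflip P Q L u).rank P Q =
    (height P Q u - height P Q (u + tip P Q L)).natAbs := rfl
  rw [h2, height_add]
  omega

theorem pflip_inj {L₁ L₂ L : List Bool} (h₁ : L₁ <:+ L) (h₂ : L₂ <:+ L) {u u' : Pt}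
    (he : pflip P Q L₁ u = pflip P Q L₂ u') : L₁ = L₂ ∧ u = u' := by
  have h3 : out P Q L₁ u true ∈ (pflip P Q L₂ u').post := he ▸ mem_post_pflip.2 ⟨true, rfl⟩
  obtain ⟨i, hi⟩ := mem_post_pflip.1 h3
  obtain ⟨h4, -, h5⟩ := h.out_eq _ _ hi
  exact ⟨h.suffix_eq_of_tip h₁ h₂ h5, h4⟩

/-- Above the bottom, an input is an output of a child and `out_eq` applies; at the bottom,
`inp_nil_eq` does. The mixed cases fail because bottom inputs lie in `T`, where heights differ by at
most 1, while outputs have spread at least 2. -/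
theorem inp_eq {L₁ L₂ L : List Bool} (h₁ : L₁ <:+ L) (h₂ : L₂ <:+ L) {u u' : Pt} {i i' : Bool}
    {T : Set (Finset Pt)} (hT : ∀ t ∈ T, ∀ a ∈ t, ∀ b ∈ t, height P Q a ≤ height P Q b + 1)
    (hb₁ : L₁ = [] → inp P Q [] u i ∈ T) (hb₂ : L₂ = [] → inp P Q [] u' i' ∈ T)
    (he : inp P Q L₁ u i = inp P Q L₂ u' i') : L₁ = L₂ ∧ u = u' := by
  have hout : ∀ L u i, out P Q L u i ∉ T := by
    intro L u i ho
    have h1 := hT _ ho (u + tip P Q L) (by cases i <;> simp [out]) u (by cases i <;> simp [out])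
    have h2 := h.height_tip L
    rw [height_add] at h1
    omega
  cases L₁ with
  | nil =>
    cases L₂ with
    | nil => exact ⟨rfl, h.inp_nil_eq he⟩
    | cons t₂ L₂ =>
      rw [inp_cons] at he
      exact absurd (he ▸ hb₁ rfl) (hout _ _ _)
  | cons t₁ L₁ =>
    cases L₂ with
    | nil =>
      rw [inp_cons] at he
      exact absurd (he.symm ▸ hb₂ rfl) (hout _ _ _)
    | cons t₂ L₂ =>
      rw [inp_cons, inp_cons] at he
      obtain ⟨h3, h4, h5⟩ := h.out_eq _ _ he
      have h6 := h.suffix_eq_of_tip ((List.suffix_cons _ _).trans h₁)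
        ((List.suffix_cons _ _).trans h₂) h5
      subst h6
      -- Suffixes of one list with the same length coincide.
      have h7 : t₁ :: L₁ = t₂ :: L₁ := by
        rcases List.suffix_or_suffix_of_suffix h₁ h₂ with h8 | h8
        · exact h8.eq_of_length rfl
        · exact (h8.eq_of_length rfl).symm
      refine ⟨h7, ?_⟩
      cases h7
      have h8 : i = i' := by cases t₁ <;> simpa using h4
      subst h8
      cases i
      · simpa using h3
      · simpa using h3

/-- The node set `K` is arbitrary, apart from closure under children and lying on one branch, so
that one plan and a union of two plans are covered together. -/
theorem isMarkedGraph {D : FlipPoset} {K : List Bool → Pt → Prop} {L : List Bool}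
    {T : Set (Finset Pt)} (hT : ∀ t ∈ T, ∀ a ∈ t, ∀ b ∈ t, height P Q a ≤ height P Q b + 1)
    (hD : D.HasNodes P Q K) (hsuf : ∀ L' u, K L' u → L' <:+ L)
    (hleft : ∀ t L' u, K (t :: L') u → K L' u)
    (hright : ∀ t L' u, K (t :: L') u → K L' (u + pivot P Q t L'))
    (hbase : ∀ u i, K [] u → inp P Q [] u i ∈ T) :
    D.IsMarkedGraph T (Flip.rank P Q) where
  crossing s hs := by
    obtain ⟨L', u, -, rfl⟩ := (hD.flips s).1 hs
    exact crossing_pflip _ _ _ _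
  pre_inj s hs t ht τ h1 h2 := by
    obtain ⟨L₁, u, hu, rfl⟩ := (hD.flips s).1 hs
    obtain ⟨L₂, u', hu', rfl⟩ := (hD.flips t).1 ht
    obtain ⟨i, rfl⟩ := mem_pre_pflip.1 h1
    obtain ⟨i', h3⟩ := mem_pre_pflip.1 h2
    obtain ⟨rfl, rfl⟩ := h.inp_eq (hsuf _ _ hu) (hsuf _ _ hu') hT
      (by rintro rfl; exact hbase _ _ hu) (by rintro rfl; exact hbase _ _ hu') h3
    rfl
  post_inj s hs t ht τ h1 h2 := by
    obtain ⟨L₁, u, hu, rfl⟩ := (hD.flips s).1 hs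
    obtain ⟨L₂, u', hu', rfl⟩ := (hD.flips t).1 ht
    obtain ⟨i, rfl⟩ := mem_post_pflip.1 h1
    obtain ⟨i', h3⟩ := mem_post_pflip.1 h2
    obtain ⟨rfl, -, h5⟩ := h.out_eq _ _ h3
    rw [h.suffix_eq_of_tip (hsuf _ _ hu) (hsuf _ _ hu') h5]
  post_not_mem s hs τ h1 h2 := by
    obtain ⟨L', u, -, rfl⟩ := (hD.flips s).1 hs
    obtain ⟨i, rfl⟩ := mem_post_pflip.1 h1
    have h3 := hT _ h2 (u + tip P Q L') (by cases i <;> simp [out]) u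
      (by cases i <;> simp [out])
    have h4 := h.height_tip L'
    rw [height_add] at h3
    omega
  pre_mem s hs τ h1 := by
    obtain ⟨L', u, hu, rfl⟩ := (hD.flips s).1 hs
    obtain ⟨i, rfl⟩ := mem_pre_pflip.1 h1
    cases L' with
    | nil => exact Or.inl (hbase _ _ hu)
    | cons t L' =>
      rw [inp_cons]
      refine Or.inr ⟨pflip P Q L' (if i then u else u + pivot P Q t L'),
        (hD.child _ _).2 ⟨t, L', u, hu, rfl, ?_⟩, mem_post_pflip.2 ⟨_, rfl⟩⟩
      cases i <;> simp
  child_mem s c hc := by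
    obtain ⟨t, L', u, hu, rfl, hc'⟩ := (hD.child s c).1 hc
    refine ⟨(hD.flips _).2 ⟨_, _, hu, rfl⟩, ?_⟩
    rcases hc' with rfl | rfl
    · exact (hD.flips _).2 ⟨_, _, hleft _ _ _ hu, rfl⟩
    · exact (hD.flips _).2 ⟨_, _, hright _ _ _ hu, rfl⟩
  child_rank s c hc := by
    obtain ⟨t, L', u, hu, rfl, hc'⟩ := (hD.child s c).1 hc
    have h1 := h.height_tip_lt (List.suffix_cons t L') (by simp)
    zify
    rcases hc' with rfl | rfl <;> rwa [h.rank_pflip, h.rank_pflip]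
  child_post s c hc := by
    obtain ⟨t, L', u, hu, rfl, hc'⟩ := (hD.child s c).1 hc
    rcases hc' with rfl | rfl
    · exact ⟨inp P Q (t :: L') u true, mem_pre_pflip.2 ⟨_, rfl⟩,
        mem_post_pflip.2 ⟨_, inp_cons ..⟩⟩
    · exact ⟨inp P Q (t :: L') u false, mem_pre_pflip.2 ⟨_, rfl⟩,
        mem_post_pflip.2 ⟨_, inp_cons ..⟩⟩

/-- The triangles created by the top flips are present after a linear ordering. -/
theorem out_mem {D : FlipPoset} {K : List Bool → Pt → Prop} {L : List Bool}
    {T : Set (Finset Pt)} {rank : Flip → ℕ} (hM : D.IsMarkedGraph T rank)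
    (hD : D.HasNodes P Q K) (hsuf : ∀ L' u, K L' u → L' <:+ L) {v : Pt} (hv : K L v)
    {l : List Flip} (hl : D.IsLinearOrdering l) {T' : Set (Finset Pt)} (hT' : FlipPath T l T')
    (i : Bool) : out P Q L v i ∈ T' := by
  refine hM.mem_of_post hl hT' ((hD.flips _).2 ⟨_, _, hv, rfl⟩) (fun s hs => ?_)
    (mem_post_pflip.2 ⟨i, rfl⟩)
  obtain ⟨t, L', u, hu, rfl, hc⟩ := (hD.child _ _).1 hs
  have h1 := hsuf _ _ hu
  -- A parent of the top flip would sit at `t :: L`, which is too long to be a suffix of `L`.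
  have h2 : L = L' := by
    rcases hc with hc | hc <;>
      exact (h.pflip_inj List.suffix_rfl ((List.suffix_cons _ _).trans h1) hc).1
  have h3 := h1.length_le
  rw [h2, List.length_cons] at h3
  omega

end IsFrame

/-! ### Equilateral lattice triangles -/

/-- The squared length of a lattice vector. -/
def sqNorm (z : Pt) : ℤ := z.1 ^ 2 + z.1 * z.2 + z.2 ^ 2

theorem dist_emb_sq (p q : Pt) : dist (emb p) (emb q) ^ 2 = (sqNorm (q - p) : ℝ) := by
  rw [dist_comm, Complex.dist_eq, ← Complex.normSq_eq_norm_sq, Complex.normSq_apply]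
  have h3 : Real.sqrt 3 * Real.sqrt 3 = 3 := Real.mul_self_sqrt (by norm_num)
  simp only [emb, sqNorm, Complex.sub_re, Complex.sub_im, Complex.add_re, Complex.add_im,
    Complex.mul_re, Complex.mul_im, Complex.intCast_re, Complex.intCast_im, Prod.fst_sub,
    Prod.snd_sub]
  push_cast
  linear_combination (((q.2 : ℝ) - p.2) ^ 2 / 4) * h3

theorem sqNorm_pos {z : Pt} (h : z ≠ 0) : 0 < sqNorm z := by
  obtain ⟨x, y⟩ := z
  have h1 : x ≠ 0 ∨ y ≠ 0 := by
    by_contra! h1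
    exact h (Prod.ext h1.1 h1.2)
  simp only [sqNorm]
  rcases h1 with h1 | h1
  · have := sq_pos_of_ne_zero h1
    nlinarith [sq_nonneg (x + 2 * y)]
  · have := sq_pos_of_ne_zero h1
    nlinarith [sq_nonneg (2 * x + y)]

/-- The third vertex of an equilateral lattice triangle. -/
theorem eq_rot_of_sqNorm {z w : Pt} (hz : z ≠ 0) (h₁ : sqNorm w = sqNorm z)
    (h₂ : sqNorm (w - z) = sqNorm z) : w = rot z ∨ z = rot w := by
  have hn := sqNorm_pos hz
  obtain ⟨x, y⟩ := z
  obtain ⟨a, b⟩ := w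
  simp only [sqNorm, Prod.mk_sub_mk, rot, Prod.mk.injEq] at *
  obtain ⟨n, hxy⟩ : ∃ n, n = x ^ 2 + x * y + y ^ 2 := ⟨_, rfl⟩
  rw [← hxy] at h₁ h₂ hn
  have hB : 2 * x * a + x * b + y * a + 2 * y * b = n := by linarith
  -- Lagrange's identity for this quadratic form: the square of the left side of `hB` plus three
  -- times the squared determinant is `4 n ^ 2`. So the determinant is `n` or `-n`, an angle of 60
  -- degrees in either direction.
  have hd : (x * b - y * a - n) * (x * b - y * a + n) = 0 := by
    have : 3 * ((x * b - y * a - n) * (x * b - y * a + n)) = 0 := by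
      linear_combination (-(2 * x * a + x * b + y * a + 2 * y * b) - n) * hB +
        4 * (x ^ 2 + x * y + y ^ 2) * h₁ - 4 * n * hxy
    omega
  rcases mul_eq_zero.1 hd with h3 | h3
  · have h4 : (x + y) * a + y * b = 0 := by linarith
    exact Or.inl ⟨mul_left_cancel₀ hn.ne' (by linear_combination x * h4 - y * h3 + a * hxy),
      mul_left_cancel₀ hn.ne' (by linear_combination (x + y) * h3 + y * h4 + b * hxy)⟩
  · have h4 : x * a + x * b + y * b = 0 := by linarith
    exact Or.inr ⟨mul_left_cancel₀ hn.ne' (by linear_combination a * h4 + b * h3 - x * h₁),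
      mul_left_cancel₀ hn.ne' (by linear_combination b * h4 - (a + b) * h3 - y * h₁)⟩

theorem sqNorm_rot (z : Pt) : sqNorm (rot z) = sqNorm z := by
  simp only [sqNorm, rot]
  ring

theorem cr_rot (z : Pt) : cr z (rot z) = sqNorm z := by
  simp only [sqNorm, rot, cr]
  ring

/-- Every large equilateral lattice triangle with a vertex at the origin contains a unit vector. -/
theorem exists_unit_mem_triangle (z : Pt) (hz : z ≠ 0) :
    ∃ u : Pt, sqNorm u = 1 ∧ 0 ≤ cr u (rot z) ∧ 0 ≤ cr z u ∧
      cr u (rot z) + cr z u ≤ sqNorm z := by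
  obtain ⟨x, y⟩ := z
  have key : ∀ a b : ℤ, 0 ≤ a → 0 ≤ b → b + a ≤ a ^ 2 + a * b + b ^ 2 := by
    intro a b ha hb
    have h1 := mul_nonneg ha hb
    have h2 : a ≤ a ^ 2 := Int.le_self_sq a
    have h3 : b ≤ b ^ 2 := Int.le_self_sq b
    linarith
  have h0 : ¬ (x = 0 ∧ y = 0) := fun h => hz (Prod.ext h.1 h.2)
  -- The six sectors of 60 degrees. The unit vector on the anticlockwise boundary ray of the sector
  -- of `z` lies between `z` and `rot z`.
  have hc : (0 ≤ x ∧ 0 ≤ y) ∨ (0 ≤ -x ∧ 0 ≤ x + y) ∨ (0 ≤ y ∧ 0 ≤ -(x + y)) ∨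
      (0 ≤ -x ∧ 0 ≤ -y) ∨ (0 ≤ x ∧ 0 ≤ -(x + y)) ∨ (0 ≤ -y ∧ 0 ≤ x + y) := by omega
  simp only [sqNorm, cr, rot]
  rcases hc with h | h | h | h | h | h
  · have := key _ _ h.1 h.2
    exact ⟨(0, 1), by norm_num, by linarith, by linarith, by linarith⟩
  · have := key _ _ h.1 h.2
    exact ⟨(-1, 1), by norm_num, by linarith, by linarith, by linarith⟩
  · have := key _ _ h.1 h.2
    exact ⟨(-1, 0), by norm_num, by linarith, by linarith, by linarith⟩
  · have := key _ _ h.1 h.2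
    exact ⟨(0, -1), by norm_num, by linarith, by linarith, by linarith⟩
  · have := key _ _ h.1 h.2
    exact ⟨(1, -1), by norm_num, by linarith, by linarith, by linarith⟩
  · have := key _ _ h.1 h.2
    exact ⟨(1, 0), by norm_num, by linarith, by linarith, by linarith⟩

theorem mem_hull_of_barycentric {a z w : Pt} {p : ℂ} {s t : ℝ} (hs : 0 ≤ s) (ht : 0 ≤ t)
    (hst : s + t ≤ 1) (hp : p = emb a + s * emb z + t * emb w) : p ∈ hull {a, a + z, a + w} := by
  have hc : Convex ℝ (hull {a, a + z, a + w}) := convex_convexHull ℝ _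
  have hm : ∀ q ∈ ({a, a + z, a + w} : Finset Pt), emb q ∈ hull {a, a + z, a + w} :=
    fun q hq => subset_convexHull ℝ _ ⟨q, hq, rfl⟩
  have := hc.sum_mem (t := Finset.univ) (w := ![1 - s - t, s, t])
    (z := ![emb a, emb (a + z), emb (a + w)])
    (by intro i _; fin_cases i <;> simp <;> linarith)
    (by simp only [Fin.sum_univ_three, Matrix.cons_val]; ring)
    (by intro i _; fin_cases i <;> exact hm _ (by simp))
  convert this using 1
  simp [Fin.sum_univ_three, emb_add, hp]
  ring

/-- The point is a vertex of some `t'`. Face-to-face position puts it in the hull of the common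
vertices, and affine independence of the vertices of `t'` makes it one of them. -/
theorem IsTriangulation.mem_of_emb_mem_hull {Ω : Set ℂ} {T : Set (Finset Pt)}
    (hT : IsTriangulation Ω T) {t : Finset Pt} (ht : t ∈ T) {p : Pt} (hp : emb p ∈ hull t) :
    p ∈ t := by
  have hΩ : emb p ∈ Ω := by
    rw [← hT.cover]
    exact Set.mem_biUnion ht hp
  obtain ⟨t', ht', hpt'⟩ := hT.uses_all p hΩ
  have h1 : emb p ∈ hull (t ∩ t') := by
    rw [← hT.face_to_face t ht t' ht']
    exact ⟨hp, subset_convexHull ℝ _ ⟨p, hpt', rfl⟩⟩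
  have h2 := convexHull_subset_affineSpan (𝕜 := ℝ) _ h1
  have h3 : emb '' ((t ∩ t' : Finset Pt) : Set Pt) =
      (fun q : t' => emb q) '' {q : t' | (q : Pt) ∈ t} := by
    ext z
    constructor
    · rintro ⟨q, hq, rfl⟩
      rw [Finset.mem_coe, Finset.mem_inter] at hq
      exact ⟨⟨q, hq.2⟩, hq.1, rfl⟩
    · rintro ⟨⟨q, hq⟩, hq', rfl⟩
      exact ⟨q, Finset.mem_coe.2 (Finset.mem_inter.2 ⟨hq', hq⟩), rfl⟩
  rw [h3] at h2
  exact ((hT.nondegenerate t' ht').mem_affineSpan_iff ⟨p, hpt'⟩ _).1 h2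

/-- The triangle contains a lattice point at unit distance from one of its corners. That point must
be a vertex, so the side length is 1. -/
theorem IsEquilateralTriangulation.exists_unit {Ω : Set ℂ} {T : Set (Finset Pt)}
    (hT : IsEquilateralTriangulation Ω T) {t : Finset Pt} (ht : t ∈ T) :
    ∃ a z, sqNorm z = 1 ∧ t = {a, a + z, a + rot z} := by
  obtain ⟨a, b, c, hab, hac, hbc, rfl⟩ := Finset.card_eq_three.1 (hT.card_eq t ht)
  have hed : ∀ p ∈ ({a, b, c} : Finset Pt), ∀ q ∈ ({a, b, c} : Finset Pt), p ≠ q →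
      s(p, q) ∈ edges T := fun p hp q hq hpq => ⟨p, q, hpq, rfl, _, ht, hp, hq⟩
  have hsq : ∀ p q r s : Pt, s(p, q) ∈ edges T → s(r, s) ∈ edges T →
      sqNorm (q - p) = sqNorm (s - r) := by
    intro p q r s h1 h2
    have := hT.equal_length p q r s h1 h2
    have h3 : (sqNorm (q - p) : ℝ) = sqNorm (s - r) := by
      rw [← dist_emb_sq, ← dist_emb_sq, this]
    exact_mod_cast h3
  have e1 := hed a (by simp) b (by simp) hab
  have e2 := hed a (by simp) c (by simp) hac
  have e3 := hed b (by simp) c (by simp) hbc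
  have hz : b - a ≠ 0 := fun h => hab (sub_eq_zero.1 h).symm
  have key : ∃ a' z, z ≠ 0 ∧ ({a, b, c} : Finset Pt) = {a', a' + z, a' + rot z} := by
    rcases eq_rot_of_sqNorm hz (hsq _ _ _ _ e2 e1)
      (by rw [sub_sub_sub_cancel_right]; exact hsq _ _ _ _ e3 e1) with h1 | h1
    · exact ⟨a, b - a, hz, by rw [← h1]; simp⟩
    · refine ⟨a, c - a, fun h => hac (sub_eq_zero.1 h).symm, ?_⟩
      rw [← h1]
      simp only [add_sub_cancel]
      rw [Finset.pair_comm]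
  obtain ⟨a', z, hz, he⟩ := key
  rw [he] at ht ⊢
  refine ⟨a', z, ?_, rfl⟩
  obtain ⟨u, hu, h1, h2, h3⟩ := exists_unit_mem_triangle z hz
  have hn : (0 : ℝ) < sqNorm z := by exact_mod_cast sqNorm_pos hz
  have h4 : emb (a' + u) ∈ hull {a', a' + z, a' + rot z} := by
    refine mem_hull_of_barycentric (s := cr u (rot z) / sqNorm z) (t := cr z u / sqNorm z)
      (div_nonneg (by exact_mod_cast h1) hn.le) (div_nonneg (by exact_mod_cast h2) hn.le) ?_ ?_
    · rw [← add_div, div_le_one hn]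
      exact_mod_cast h3
    · rw [emb_add, add_assoc]
      congr 1
      have hn' : (sqNorm z : ℂ) ≠ 0 := by exact_mod_cast (sqNorm_pos hz).ne'
      push_cast
      field_simp
      simp only [emb, sqNorm, cr, rot]
      push_cast
      ring
  have h5 := hT.mem_of_emb_mem_hull ht h4
  simp only [Finset.mem_insert, Finset.mem_singleton, add_eq_left, add_right_inj] at h5
  rcases h5 with rfl | rfl | rfl
  · simp [sqNorm] at hu
  · exact hu
  · rwa [sqNorm_rot] at hu

/-! ### The triangles of an equilateral triangulation -/

/-- `P` and `Q` are unit vectors at an angle of 60 degrees. -/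
def IsUnitFrame (P Q : Pt) : Prop :=
  (sqNorm P = 1 ∧ Q = rot P) ∨ (sqNorm Q = 1 ∧ P = rot Q)

theorem IsUnitFrame.isFrame {P Q : Pt} (h : IsUnitFrame P Q) : IsFrame P Q := by
  rcases h with ⟨h, rfl⟩ | ⟨h, rfl⟩
  · rw [IsFrame, cr_rot, h, one_mul]
  · have : cr (rot Q) Q = -cr Q (rot Q) := by simp only [cr]; ring
    rw [IsFrame, this, cr_rot, h]
    norm_num

theorem eq_of_sqNorm_one {z : Pt} (h : sqNorm z = 1) :
    z = (1, 0) ∨ z = (0, 1) ∨ z = (-1, 1) ∨ z = (-1, 0) ∨ z = (0, -1) ∨ z = (1, -1) := by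
  obtain ⟨x, y⟩ := z
  simp only [sqNorm] at h
  have h1 : x ≤ 1 := by nlinarith [sq_nonneg (x + 2 * y)]
  have h2 : -1 ≤ x := by nlinarith [sq_nonneg (x + 2 * y)]
  have h3 : y ≤ 1 := by nlinarith [sq_nonneg (2 * x + y)]
  have h4 : -1 ≤ y := by nlinarith [sq_nonneg (2 * x + y)]
  interval_cases x <;> interval_cases y <;> simp_all

theorem inp_nil_swap (P Q u : Pt) (i : Bool) : inp P Q [] u i = inp Q P [] u i := by
  cases i <;> simp only [inp, basis, tip, add_comm Q P]
  · rw [Finset.insert_comm]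
  · rw [Finset.pair_comm]

theorem exists_inp_of_unit {P Q a z : Pt} (h : IsUnitFrame P Q) (hz : sqNorm z = 1) :
    ∃ u i, ({a, a + z, a + rot z} : Finset Pt) = inp P Q [] u i := by
  wlog hPQ : sqNorm P = 1 ∧ Q = rot P generalizing P Q
  · obtain ⟨u, i, h1⟩ := this (Or.inl (h.resolve_left hPQ)) (h.resolve_left hPQ)
    exact ⟨u, i, h1.trans (inp_nil_swap _ _ _ _)⟩
  obtain ⟨hP, rfl⟩ := hPQ
  -- All unit vectors are rotations of `P`; each of the six directions fixes the orientation of the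
  -- triangle and its base point `u`.
  have hzP : z = P ∨ z = rot P ∨ z = rot P - P ∨ z = -P ∨ z = -rot P ∨ z = P - rot P := by
    rcases eq_of_sqNorm_one hP with rfl | rfl | rfl | rfl | rfl | rfl <;>
    rcases eq_of_sqNorm_one hz with rfl | rfl | rfl | rfl | rfl | rfl <;> decide
  obtain ⟨p, q⟩ := P
  obtain ⟨a, b⟩ := a
  rcases hzP with rfl | rfl | rfl | rfl | rfl | rfl
  · exact ⟨(a, b), true, by
      ext ⟨x, y⟩; simp [inp, basis, rot]⟩
  · exact ⟨(a, b) - (p, q), false, by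
      ext ⟨x, y⟩; simp [inp, basis, tip, rot]; omega⟩
  · exact ⟨(a, b) - (p, q), true, by
      ext ⟨x, y⟩; simp [inp, basis, rot]; omega⟩
  · exact ⟨(a, b) - (p, q) - rot (p, q), false, by
      ext ⟨x, y⟩; simp [inp, basis, tip, rot]; omega⟩
  · exact ⟨(a, b) - rot (p, q), true, by
      ext ⟨x, y⟩; simp [inp, basis, rot]; omega⟩
  · exact ⟨(a, b) - rot (p, q), false, by
      ext ⟨x, y⟩; simp [inp, basis, tip, rot]; omega⟩

theorem IsEquilateralTriangulation.exists_inp {Ω : Set ℂ} {T : Set (Finset Pt)}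
    (hT : IsEquilateralTriangulation Ω T) {P Q : Pt} (h : IsUnitFrame P Q) {t : Finset Pt}
    (ht : t ∈ T) : ∃ u i, t = inp P Q [] u i := by
  obtain ⟨a, z, hz, rfl⟩ := hT.exists_unit ht
  exact exists_inp_of_unit h hz

/-- This bound separates the initial triangles from the created ones. -/
theorem IsEquilateralTriangulation.height_le {Ω : Set ℂ} {T : Set (Finset Pt)}
    (hT : IsEquilateralTriangulation Ω T) {P Q : Pt} (h : IsUnitFrame P Q) {t : Finset Pt}
    (ht : t ∈ T) {a b : Pt} (ha : a ∈ t) (hb : b ∈ t) :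
    height P Q a ≤ height P Q b + 1 := by
  obtain ⟨u, i, rfl⟩ := hT.exists_inp h ht
  have h1 := h.isFrame.height_left
  have h2 := h.isFrame.height_right
  cases i <;> simp only [inp, basis, tip, Finset.mem_insert, Finset.mem_singleton] at ha hb <;>
    rcases ha with rfl | rfl | rfl <;> rcases hb with rfl | rfl | rfl <;>
    (try simp only [height_add]) <;> omega

/-! ### Coordinates -/

/-- The first coordinate of a lattice vector with respect to `P` and `Q`. -/
def xc (P Q u : Pt) : ℤ := cr P Q * cr u Q

/-- The second coordinate of a lattice vector with respect to `P` and `Q`. -/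
def yc (P Q u : Pt) : ℤ := cr P Q * cr P u

theorem xc_add (P Q a b : Pt) : xc P Q (a + b) = xc P Q a + xc P Q b := by
  simp only [xc, cr, Prod.fst_add, Prod.snd_add]; ring

theorem yc_add (P Q a b : Pt) : yc P Q (a + b) = yc P Q a + yc P Q b := by
  simp only [yc, cr, Prod.fst_add, Prod.snd_add]; ring

namespace IsFrame

variable {P Q : Pt} (h : IsFrame P Q)

include h

theorem xc_left : xc P Q P = 1 := h
theorem yc_right : yc P Q Q = 1 := h

omit h in
theorem xc_right : xc P Q Q = 0 := by simp only [xc, cr]; ring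

omit h in
theorem yc_left : yc P Q P = 0 := by simp only [yc, cr]; ring

theorem xc_comb (m n : ℤ) : xc P Q (m • P + n • Q) = m := by
  have := h.xc_left
  have h2 := xc_right (P := P) (Q := Q)
  simp only [xc, cr, Prod.fst_add, Prod.snd_add, Prod.smul_fst, Prod.smul_snd, smul_eq_mul] at *
  linear_combination m * this + n * h2

theorem yc_comb (m n : ℤ) : yc P Q (m • P + n • Q) = n := by
  have := h.yc_right
  have h2 := yc_left (P := P) (Q := Q)
  simp only [yc, cr, Prod.fst_add, Prod.snd_add, Prod.smul_fst, Prod.smul_snd, smul_eq_mul] at *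
  linear_combination n * this + m * h2

theorem ext_coord {a b : Pt} (hx : xc P Q a = xc P Q b) (hy : yc P Q a = yc P Q b) : a = b := by
  unfold IsFrame at h
  simp only [xc, yc] at hx hy
  have hD : cr P Q ≠ 0 := by rintro h1; simp [h1] at h
  have h1 := mul_left_cancel₀ hD hx
  have h2 := mul_left_cancel₀ hD hy
  simp only [cr] at h1 h2 hD
  refine Prod.ext (mul_left_cancel₀ hD ?_) (mul_left_cancel₀ hD ?_)
  · linear_combination P.1 * h1 + Q.1 * h2
  · linear_combination P.2 * h1 + Q.2 * h2

end IsFrame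

/-- The first coordinate of a point of the plane with respect to `1` and `ω`. -/
noncomputable def re₀ : ℂ →ₗ[ℝ] ℝ := Complex.reLm - (1 / Real.sqrt 3) • Complex.imLm

/-- The second coordinate of a point of the plane with respect to `1` and `ω`. -/
noncomputable def im₀ : ℂ →ₗ[ℝ] ℝ := (2 / Real.sqrt 3) • Complex.imLm

theorem re₀_emb (p : Pt) : re₀ (emb p) = p.1 := by
  have h3 : Real.sqrt 3 ≠ 0 := by positivity
  simp [re₀, emb]
  field_simp
  ring

theorem im₀_emb (p : Pt) : im₀ (emb p) = p.2 := by
  have h3 : Real.sqrt 3 ≠ 0 := by positivity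
  simp [im₀, emb]
  field_simp

/-- The first coordinate of a point of the plane with respect to `P` and `Q`. -/
noncomputable def xr (P Q : Pt) : ℂ →ₗ[ℝ] ℝ :=
  (cr P Q * Q.2 : ℝ) • re₀ - (cr P Q * Q.1 : ℝ) • im₀

/-- The second coordinate of a point of the plane with respect to `P` and `Q`. -/
noncomputable def yr (P Q : Pt) : ℂ →ₗ[ℝ] ℝ :=
  (cr P Q * P.1 : ℝ) • im₀ - (cr P Q * P.2 : ℝ) • re₀

theorem xr_emb (P Q p : Pt) : xr P Q (emb p) = xc P Q p := by
  simp only [xr, xc, LinearMap.sub_apply, LinearMap.smul_apply, re₀_emb, im₀_emb, smul_eq_mul]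
  simp only [cr]
  push_cast
  ring

theorem yr_emb (P Q p : Pt) : yr P Q (emb p) = yc P Q p := by
  simp only [yr, yc, LinearMap.sub_apply, LinearMap.smul_apply, re₀_emb, im₀_emb, smul_eq_mul]
  simp only [cr]
  push_cast
  ring

theorem le_of_mem_hull (f : ℂ →ₗ[ℝ] ℝ) {c : ℝ} {t : Finset Pt} (h : ∀ p ∈ t, f (emb p) ≤ c)
    {z : ℂ} (hz : z ∈ hull t) : f z ≤ c := by
  have : hull t ⊆ {z | f z ≤ c} := by
    refine convexHull_min ?_ (convex_halfSpace_le f.isLinear c)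
    rintro _ ⟨p, hp, rfl⟩
    exact h p hp
  exact this hz

theorem ge_of_mem_hull (f : ℂ →ₗ[ℝ] ℝ) {c : ℝ} {t : Finset Pt} (h : ∀ p ∈ t, c ≤ f (emb p))
    {z : ℂ} (hz : z ∈ hull t) : c ≤ f z := by
  have := le_of_mem_hull (-f) (c := -c) (fun p hp => by simpa using h p hp) hz
  simpa using this

/-! ### Half-planes that contain the unit triangles -/

namespace IsFrame

variable {P Q : Pt} (h : IsFrame P Q)

include h

theorem of_mem_hull_true {u : Pt} {z : ℂ} (hz : z ∈ hull (inp P Q [] u true)) :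
    xc P Q u ≤ xr P Q z ∧ yc P Q u ≤ yr P Q z ∧
      xr P Q z + yr P Q z ≤ xc P Q u + yc P Q u + 1 := by
  refine ⟨ge_of_mem_hull _ ?_ hz, ge_of_mem_hull _ ?_ hz,
    le_of_mem_hull (xr P Q + yr P Q) ?_ hz⟩ <;> intro p hp <;>
  simp only [inp, basis, Finset.mem_insert, Finset.mem_singleton] at hp <;>
  rcases hp with rfl | rfl | rfl <;>
  simp only [LinearMap.add_apply, xr_emb, yr_emb, xc_add, yc_add, h.xc_left, h.yc_right, xc_right,
    yc_left] <;> push_cast <;> linarith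

theorem of_mem_hull_false {u : Pt} {z : ℂ} (hz : z ∈ hull (inp P Q [] u false)) :
    xr P Q z ≤ xc P Q u + 1 ∧ yr P Q z ≤ yc P Q u + 1 ∧
      xc P Q u + yc P Q u + 1 ≤ xr P Q z + yr P Q z := by
  refine ⟨le_of_mem_hull _ ?_ hz, le_of_mem_hull _ ?_ hz,
    ge_of_mem_hull (xr P Q + yr P Q) ?_ hz⟩ <;> intro p hp <;>
  simp only [inp, basis, tip, Finset.mem_insert, Finset.mem_singleton] at hp <;>
  rcases hp with rfl | rfl | rfl <;>
  simp only [LinearMap.add_apply, xr_emb, yr_emb, xc_add, yc_add, h.xc_left, h.yc_right, xc_right,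
    yc_left] <;> push_cast <;> linarith

end IsFrame

/-! ### Unit triangles and edges that the region forces into the triangulation -/

namespace IsEquilateralTriangulation

variable {Ω : Set ℂ} {T : Set (Finset Pt)} (hT : IsEquilateralTriangulation Ω T)
  {P Q : Pt} (h : IsUnitFrame P Q)

include hT h

/-- The triangle of the triangulation that contains a given point. -/
theorem exists_inp_mem_hull {z : ℂ} (hz : z ∈ Ω) :
    ∃ u i, inp P Q [] u i ∈ T ∧ z ∈ hull (inp P Q [] u i) := by
  rw [← hT.cover] at hz
  simp only [Set.mem_iUnion] at hz
  obtain ⟨t, ht, hz⟩ := hz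
  obtain ⟨u, i, rfl⟩ := hT.exists_inp h ht
  exact ⟨u, i, ht, hz⟩

/-- Some unit triangle of `T` contains `z`. Since `z` is interior to the triangle at `u`, the
half-plane inequalities, read between integers, leave only that triangle. -/
theorem inp_true_mem {u : Pt} {z : ℂ} (hz : z ∈ Ω) (hx : xc P Q u < xr P Q z)
    (hy : yc P Q u < yr P Q z) (hxy : xr P Q z + yr P Q z < xc P Q u + yc P Q u + 1) :
    inp P Q [] u true ∈ T := by
  obtain ⟨u', i, ht, hz⟩ := hT.exists_inp_mem_hull h hz
  have hF := h.isFrame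
  cases i
  · obtain ⟨h1, h2, h3⟩ := hF.of_mem_hull_false hz
    have e1 : xc P Q u < xc P Q u' + 1 := by exact_mod_cast hx.trans_le h1
    have e2 : yc P Q u < yc P Q u' + 1 := by exact_mod_cast hy.trans_le h2
    have e3 : xc P Q u' + yc P Q u' + 1 < xc P Q u + yc P Q u + 1 := by
      exact_mod_cast h3.trans_lt hxy
    omega
  · obtain ⟨h1, h2, h3⟩ := hF.of_mem_hull_true hz
    have e1 : (xc P Q u + yc P Q u' : ℝ) < xc P Q u' + yc P Q u' + 1 := by linarith
    have e2 : (xc P Q u' + yc P Q u : ℝ) < xc P Q u' + yc P Q u' + 1 := by linarith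
    have e3 : (xc P Q u' + yc P Q u : ℝ) < xc P Q u + yc P Q u + 1 := by linarith
    have e4 : (xc P Q u + yc P Q u' : ℝ) < xc P Q u + yc P Q u + 1 := by linarith
    norm_cast at e1 e2 e3 e4
    rwa [hF.ext_coord (a := u) (b := u') (by omega) (by omega)]

theorem inp_false_mem {u : Pt} {z : ℂ} (hz : z ∈ Ω) (hx : xr P Q z < xc P Q u + 1)
    (hy : yr P Q z < yc P Q u + 1) (hxy : xc P Q u + yc P Q u + 1 < xr P Q z + yr P Q z) :
    inp P Q [] u false ∈ T := by
  obtain ⟨u', i, ht, hz⟩ := hT.exists_inp_mem_hull h hz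
  have hF := h.isFrame
  cases i
  · obtain ⟨h1, h2, h3⟩ := hF.of_mem_hull_false hz
    have e1 : (xc P Q u' + yc P Q u' + 1 : ℝ) < xc P Q u + yc P Q u' + 2 := by linarith
    have e2 : (xc P Q u' + yc P Q u' + 1 : ℝ) < xc P Q u' + yc P Q u + 2 := by linarith
    have e3 : (xc P Q u + yc P Q u + 1 : ℝ) < xc P Q u' + yc P Q u + 2 := by linarith
    have e4 : (xc P Q u + yc P Q u + 1 : ℝ) < xc P Q u + yc P Q u' + 2 := by linarith
    norm_cast at e1 e2 e3 e4
    rwa [hF.ext_coord (a := u) (b := u') (by omega) (by omega)]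
  · obtain ⟨h1, h2, h3⟩ := hF.of_mem_hull_true hz
    have e1 : (xc P Q u' : ℝ) < xc P Q u + 1 := by linarith
    have e2 : (yc P Q u' : ℝ) < yc P Q u + 1 := by linarith
    have e3 : (xc P Q u + yc P Q u + 1 : ℝ) < xc P Q u' + yc P Q u' + 1 := by linarith
    norm_cast at e1 e2 e3
    omega

/-- A unit edge in the region is an edge of the triangulation. -/
theorem mem_edges_of_unit {v : Pt} (hseg : segment ℝ (emb v) (emb (v + P)) ⊆ Ω) :
    s(v, v + P) ∈ edges T := by
  have hF := h.isFrame
  have hne : v ≠ v + P := by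
    intro h1
    have h2 : P = 0 := by simpa using h1.symm
    have h3 := hF.xc_left
    simp [h2, xc, cr] at h3
  -- Any unit triangle containing the midpoint of a unit edge has that whole edge as a side.
  obtain ⟨u, i, ht, hz⟩ := hT.exists_inp_mem_hull h
    (hseg (midpoint_mem_segment (emb v) (emb (v + P))))
  have ex : xr P Q (midpoint ℝ (emb v) (emb (v + P))) = xc P Q v + 1 / 2 := by
    rw [midpoint_eq_smul_add, map_smul, map_add, xr_emb, xr_emb, xc_add, hF.xc_left]
    simp only [invOf_eq_inv, smul_eq_mul]; push_cast; ring
  have ey : yr P Q (midpoint ℝ (emb v) (emb (v + P))) = yc P Q v := by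
    rw [midpoint_eq_smul_add, map_smul, map_add, yr_emb, yr_emb, yc_add, IsFrame.yc_left]
    simp only [invOf_eq_inv, smul_eq_mul]; push_cast; ring
  refine ⟨v, v + P, hne, rfl, _, ht, ?_⟩
  cases i
  · obtain ⟨h1, h2, h3⟩ := hF.of_mem_hull_false hz
    rw [ex] at h1 h3
    rw [ey] at h2 h3
    have e1 : (xc P Q v : ℝ) < xc P Q u + 1 := by linarith
    have e3 : (xc P Q u + yc P Q u : ℝ) < xc P Q v + yc P Q v := by linarith
    have e4 : (xc P Q u + yc P Q v : ℝ) < xc P Q u + yc P Q u + 2 := by linarith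
    norm_cast at e1 e3 e4 h2
    have hv : v = u + Q := hF.ext_coord
      (by rw [xc_add, IsFrame.xc_right]; omega) (by rw [yc_add, hF.yc_right]; omega)
    subst hv
    simp [inp, basis, tip, add_assoc, add_comm P Q]
  · obtain ⟨h1, h2, h3⟩ := hF.of_mem_hull_true hz
    rw [ex] at h1 h3
    rw [ey] at h2 h3
    have e1 : (xc P Q u : ℝ) < xc P Q v + 1 := by linarith
    have e3 : (xc P Q v + yc P Q v : ℝ) < xc P Q u + yc P Q u + 1 := by linarith
    norm_cast at e1 e3 h2
    have hv : v = u := hF.ext_coord (by omega) (by omega)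
    subst hv
    simp [inp, basis]

/-- If the segment from `v` along `m P + n Q` crosses the diagonal of the unit rhombus at `u`,
then both halves of the rhombus belong to the triangulation. -/
theorem inp_mem_of_crossing {v u : Pt} {m n i j : ℤ}
    (hseg : segment ℝ (emb v) (emb (v + (m • P + n • Q))) ⊆ Ω) (hu : u = v + (i • P + j • Q))
    (hi : 0 ≤ i) (him : i < m) (hj : 0 ≤ j) (hjn : j < n) (h₁ : m * j < n * (i + 1))
    (h₂ : n * i < m * (j + 1)) (b : Bool) : inp P Q [] u b ∈ T := by
  have hF := h.isFrame
  have hxu : (xc P Q u : ℝ) = xc P Q v + i := by rw [hu, xc_add, hF.xc_comb]; push_cast; ring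
  have hyu : (yc P Q u : ℝ) = yc P Q v + j := by rw [hu, yc_add, hF.yc_comb]; push_cast; ring
  have key : ∀ s : ℝ, 0 ≤ s → s ≤ 1 → ∃ z ∈ Ω, xr P Q z = xc P Q v + s * m ∧
      yr P Q z = yc P Q v + s * n := by
    intro s h0 h1
    refine ⟨_, hseg ⟨1 - s, s, by linarith, h0, by ring, rfl⟩, ?_, ?_⟩
    · rw [map_add, map_smul, map_smul, xr_emb, xr_emb, xc_add, hF.xc_comb]
      simp only [smul_eq_mul]; push_cast; ring
    · rw [map_add, map_smul, map_smul, yr_emb, yr_emb, yc_add, hF.yc_comb]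
      simp only [smul_eq_mul]; push_cast; ring
  have r1 : (m * j + 1 : ℝ) ≤ n * (i + 1) := by exact_mod_cast h₁
  have r2 : (n * i + 1 : ℝ) ≤ m * (j + 1) := by exact_mod_cast h₂
  have r3 : (i + 1 : ℝ) ≤ m := by exact_mod_cast him
  have r4 : (j + 1 : ℝ) ≤ n := by exact_mod_cast hjn
  have r5 : (0 : ℝ) ≤ i := by exact_mod_cast hi
  have r6 : (0 : ℝ) ≤ j := by exact_mod_cast hj
  -- The segment meets the diagonal line at parameter `(i + j + 1) / N`. There integrality leaves
  -- slack at least `1 / N` to the ends of the diagonal, so a shift by `1 / (2 * N ^ 2)` forwards or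
  -- backwards stays inside the rhombus and enters one half.
  obtain ⟨N, hN⟩ : ∃ N : ℝ, N = m + n := ⟨_, rfl⟩
  have hN0 : 0 < N := by linarith
  have hN2 : 2 ≤ N := by linarith
  cases b
  · obtain ⟨z, hz, h3, h4⟩ := key ((i + j + 1) / N + 1 / (2 * N ^ 2)) (by positivity) (by
      have : (1 : ℝ) - ((i + j + 1) / N + 1 / (2 * N ^ 2)) =
        (2 * N * (N - (i + j + 1)) - 1) / (2 * N ^ 2) := by field_simp; ring
      have h5 : 0 ≤ (2 * N * (N - (i + j + 1)) - 1) / (2 * N ^ 2) :=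
        div_nonneg (by nlinarith) (by positivity)
      linarith)
    refine hT.inp_false_mem h hz ?_ ?_ ?_
    · have : (i : ℝ) + 1 - ((i + j + 1) / N + 1 / (2 * N ^ 2)) * m =
        (2 * N * (n * (i + 1) - m * j) - m) / (2 * N ^ 2) := by rw [hN] at *; field_simp; ring
      have h5 : 0 < (2 * N * (n * (i + 1) - m * j) - m) / (2 * N ^ 2) :=
        div_pos (by nlinarith) (by positivity)
      rw [h3, hxu]; linarith
    · have : (j : ℝ) + 1 - ((i + j + 1) / N + 1 / (2 * N ^ 2)) * n =
        (2 * N * (m * (j + 1) - n * i) - n) / (2 * N ^ 2) := by rw [hN] at *; field_simp; ring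
      have h5 : 0 < (2 * N * (m * (j + 1) - n * i) - n) / (2 * N ^ 2) :=
        div_pos (by nlinarith) (by positivity)
      rw [h4, hyu]; linarith
    · have : ((i + j + 1) / N + 1 / (2 * N ^ 2)) * m + ((i + j + 1) / N + 1 / (2 * N ^ 2)) * n =
        i + j + 1 + 1 / (2 * N) := by rw [hN] at *; field_simp
      have h5 : 0 < 1 / (2 * N) := by positivity
      rw [h3, h4, hxu, hyu]; linarith
  · obtain ⟨z, hz, h3, h4⟩ := key ((i + j + 1) / N - 1 / (2 * N ^ 2)) (by
      have : (i + j + 1) / N - 1 / (2 * N ^ 2) =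
        (2 * N * (i + j + 1) - 1) / (2 * N ^ 2) := by field_simp
      rw [this]
      exact div_nonneg (by nlinarith) (by positivity)) (by
      have : (1 : ℝ) - ((i + j + 1) / N - 1 / (2 * N ^ 2)) =
        (2 * N * (N - (i + j + 1)) + 1) / (2 * N ^ 2) := by field_simp; ring
      have h5 : 0 ≤ (2 * N * (N - (i + j + 1)) + 1) / (2 * N ^ 2) :=
        div_nonneg (by nlinarith) (by positivity)
      linarith)
    refine hT.inp_true_mem h hz ?_ ?_ ?_
    · have : ((i + j + 1) / N - 1 / (2 * N ^ 2)) * m - i =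
        (2 * N * (m * (j + 1) - n * i) - m) / (2 * N ^ 2) := by rw [hN] at *; field_simp; ring
      have h5 : 0 < (2 * N * (m * (j + 1) - n * i) - m) / (2 * N ^ 2) :=
        div_pos (by nlinarith) (by positivity)
      rw [h3, hxu]; linarith
    · have : ((i + j + 1) / N - 1 / (2 * N ^ 2)) * n - j =
        (2 * N * (n * (i + 1) - m * j) - n) / (2 * N ^ 2) := by rw [hN] at *; field_simp; ring
      have h5 : 0 < (2 * N * (n * (i + 1) - m * j) - n) / (2 * N ^ 2) :=
        div_pos (by nlinarith) (by positivity)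
      rw [h4, hyu]; linarith
    · have : ((i + j + 1) / N - 1 / (2 * N ^ 2)) * m + ((i + j + 1) / N - 1 / (2 * N ^ 2)) * n =
        i + j + 1 - 1 / (2 * N) := by rw [hN] at *; field_simp
      have h5 : 0 < 1 / (2 * N) := by positivity
      rw [h3, h4, hxu, hyu]; linarith

end IsEquilateralTriangulation

/-- The rhombus at a node is crossed by the edge at the root, in local coordinates. -/
theorem Node.crossing {P Q : Pt} {L L' : List Bool} {v u : Pt} (h : Node P Q L v L' u) :
    ∃ m n i j : ℤ, tip P Q L = m • (basis P Q L').1 + n • (basis P Q L').2 ∧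
      u = v + (i • (basis P Q L').1 + j • (basis P Q L').2) ∧
      0 ≤ i ∧ i < m ∧ 0 ≤ j ∧ j < n ∧ m * j < n * (i + 1) ∧ n * i < m * (j + 1) := by
  induction h with
  | root => exact ⟨1, 1, 0, 0, by simp [tip], by simp, by norm_num⟩
  | @left t L' u _ ih =>
    obtain ⟨m, n, i, j, h1, h2, h3, h4, h5, h6, h7, h8⟩ := ih
    cases t
    -- Undoing a mediant step is a shear of the coordinates. The last two inequalities say that the
    -- ends of the old diagonal lie strictly on opposite sides of the line along the root edge.
    · exact ⟨m, m + n, i, i + j, by rw [h1, basis]; module, by rw [h2, basis]; module,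
        by omega, by omega, by omega, by omega, by linarith, by linarith⟩
    · exact ⟨m + n, n, i + j, j, by rw [h1, basis]; module, by rw [h2, basis]; module,
        by omega, by omega, by omega, by omega, by linarith, by linarith⟩
  | @right t L' u _ ih =>
    obtain ⟨m, n, i, j, h1, h2, h3, h4, h5, h6, h7, h8⟩ := ih
    cases t
    · exact ⟨m, m + n, i, i + j + 1, by rw [h1, basis]; module,
        by rw [h2, basis, pivot]; module,
        by omega, by omega, by omega, by omega, by linarith, by linarith⟩
    · exact ⟨m + n, n, i + j + 1, j, by rw [h1, basis]; module,
        by rw [h2, basis, pivot]; module,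
        by omega, by omega, by omega, by omega, by linarith, by linarith⟩

theorem IsEquilateralTriangulation.inp_mem_of_node {Ω : Set ℂ} {T : Set (Finset Pt)}
    (hT : IsEquilateralTriangulation Ω T) {P Q : Pt} (h : IsUnitFrame P Q) {L : List Bool}
    {v u : Pt} (hseg : segment ℝ (emb v) (emb (v + tip P Q L)) ⊆ Ω) (hn : Node P Q L v [] u)
    (b : Bool) : inp P Q [] u b ∈ T := by
  obtain ⟨m, n, i, j, h1, h2, h3, h4, h5, h6, h7, h8⟩ := hn.crossing
  rw [h1] at hseg
  exact hT.inp_mem_of_crossing h hseg h2 h3 h4 h5 h6 h7 h8 b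

/-! ### Sorted lists of fractions -/

theorem getLastD_eq_of_pairwise {Y : List ℚ} (hY : Y.Pairwise (· ≤ ·)) {p : ℚ} (hp : p ∈ Y)
    (hmax : ∀ y ∈ Y, y ≤ p) (d : ℚ) : Y.getLastD d = p := by
  rcases List.eq_nil_or_concat Y with rfl | ⟨Y', z, rfl⟩
  · simp at hp
  · rw [List.concat_eq_append] at hY hp hmax ⊢
    rw [List.pairwise_append] at hY
    have h1 : z ≤ p := hmax z (by simp)
    have h2 : p ≤ z := by
      rcases List.mem_append.1 hp with h | h
      · exact hY.2.2 p h z (by simp)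
      · exact (List.mem_singleton.1 h).le
    rw [List.getLastD_eq_getLast?]
    simp [le_antisymm h1 h2]

theorem headD_eq_of_pairwise {Y : List ℚ} (hY : Y.Pairwise (· ≤ ·)) {p : ℚ} (hp : p ∈ Y)
    (hmin : ∀ y ∈ Y, p ≤ y) (d : ℚ) : Y.headD d = p := by
  cases Y with
  | nil => simp at hp
  | cons z Y =>
    rw [List.pairwise_cons] at hY
    have h1 : p ≤ z := hmin z (by simp)
    have h2 : z ≤ p := by
      rcases List.mem_cons.1 hp with h | h
      · exact h.ge
      · exact hY.1 p h
    exact le_antisymm h2 h1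

theorem before_eq {X : List ℚ} (hX : X.Pairwise (· ≤ ·)) {p d : ℚ} (hp : p ∈ X) (hpd : p < d)
    (hmax : ∀ x ∈ X, x < d → x ≤ p) : before X d = p :=
  getLastD_eq_of_pairwise (hX.filter _) (by simp [hp, hpd])
    (fun y hy => by simp only [List.mem_filter, decide_eq_true_eq] at hy; exact hmax y hy.1 hy.2) _

theorem after_eq {X : List ℚ} (hX : X.Pairwise (· ≤ ·)) {p d : ℚ} (hp : p ∈ X) (hpd : d < p)
    (hmin : ∀ x ∈ X, d < x → p ≤ x) : after X d = p :=
  headD_eq_of_pairwise (hX.filter _) (by simp [hp, hpd])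
    (fun y hy => by simp only [List.mem_filter, decide_eq_true_eq] at hy; exact hmin y hy.1 hy.2) _

theorem pairwise_fareySeq (n : ℕ) : (fareySeq n).Pairwise (· ≤ ·) := Finset.pairwise_sort _ _

theorem mem_fareySeq {n : ℕ} {x : ℚ} :
    x ∈ fareySeq n ↔ ∃ a b : ℕ, a ≤ b ∧ 1 ≤ b ∧ b ≤ n ∧ (a : ℚ) / b = x := by
  simp only [fareySeq, Finset.mem_sort, Finset.mem_image, Finset.mem_filter, Finset.mem_product,
    Finset.mem_range, Finset.mem_Icc, Prod.exists]
  constructor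
  · rintro ⟨a, b, ⟨⟨h1, h2, h3⟩, h4⟩, h5⟩
    exact ⟨a, b, h4, h2, h3, h5⟩
  · rintro ⟨a, b, h1, h2, h3, h4⟩
    exact ⟨a, b, ⟨⟨by omega, h2, h3⟩, h1⟩, h4⟩

/-! ### The Stern–Brocot tree -/

/-- The fraction with given numerator and denominator. -/
def frac (p : ℕ × ℕ) : ℚ := (p.1 : ℚ) / p.2

theorem frac_lt_frac {p r : ℕ × ℕ} (hp : 0 < p.2) (hr : 0 < r.2) :
    frac p < frac r ↔ p.1 * r.2 < r.1 * p.2 := by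
  rw [frac, frac, div_lt_div_iff₀ (by exact_mod_cast hp) (by exact_mod_cast hr)]
  exact_mod_cast Iff.rfl

theorem num_frac {p : ℕ × ℕ} (hp : 0 < p.2) (h : p.1.Coprime p.2) : (frac p).num = p.1 := by
  have := Rat.num_div_eq_of_coprime (a := p.1) (b := p.2) (by exact_mod_cast hp) (by simpa using h)
  simpa [frac] using this

theorem den_frac {p : ℕ × ℕ} (hp : 0 < p.2) (h : p.1.Coprime p.2) : (frac p).den = p.2 := by
  have := Rat.den_div_eq_of_coprime (a := p.1) (b := p.2) (by exact_mod_cast hp) (by simpa using h)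
  simp only [Int.cast_natCast] at this
  exact_mod_cast this

theorem mediant_frac {p r : ℕ × ℕ} (hp : 0 < p.2) (hp' : p.1.Coprime p.2) (hr : 0 < r.2)
    (hr' : r.1.Coprime r.2) : mediant (frac p) (frac r) = frac (p + r) := by
  rw [mediant, num_frac hp hp', num_frac hr hr', den_frac hp hp', den_frac hr hr', frac]
  push_cast [Prod.fst_add, Prod.snd_add]
  rfl

/-- The lower neighbor of a node of the Stern–Brocot tree. -/
def lo (L : List Bool) : ℕ × ℕ := (basis ((0, 1) : ℕ × ℕ) (1, 0) L).1

/-- The upper neighbor of a node of the Stern–Brocot tree. -/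
def hi (L : List Bool) : ℕ × ℕ := (basis ((0, 1) : ℕ × ℕ) (1, 0) L).2

/-- The node of the Stern–Brocot tree, the mediant of its neighbors. -/
def med (L : List Bool) : ℕ × ℕ := lo L + hi L

/-- The determinant is invariant under mediant steps; coprimality and the denominator bound both
rest on this. -/
theorem unimodular (L : List Bool) : (hi L).1 * (lo L).2 = (lo L).1 * (hi L).2 + 1 := by
  induction L with
  | nil => rfl
  | cons t L ih =>
    cases t <;> simp only [lo, hi, basis, Prod.fst_add, Prod.snd_add] at ih ⊢ <;> nlinarith

theorem lo_pos (L : List Bool) : 0 < (lo L).2 := by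
  rcases Nat.eq_zero_or_pos (lo L).2 with h | h
  · have := unimodular L
    rw [h] at this
    omega
  · exact h

theorem coprime_of_unimodular {a b c d : ℕ} (h : c * b = a * d + 1) :
    a.Coprime b ∧ c.Coprime d := by
  have h' : (c * b : ℤ) = a * d + 1 := by exact_mod_cast h
  exact ⟨Nat.isCoprime_iff_coprime.1 ⟨-d, c, by linear_combination h'⟩,
    Nat.isCoprime_iff_coprime.1 ⟨b, -a, by linear_combination h'⟩⟩

theorem coprime_lo (L : List Bool) : (lo L).1.Coprime (lo L).2 :=
  (coprime_of_unimodular (unimodular L)).1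

theorem coprime_hi (L : List Bool) : (hi L).1.Coprime (hi L).2 :=
  (coprime_of_unimodular (unimodular L)).2

theorem med_pos (L : List Bool) : 0 < (med L).2 := Nat.add_pos_left (lo_pos L) _

theorem coprime_med (L : List Bool) : (med L).1.Coprime (med L).2 := by
  -- The mediant is the upper neighbor after a further left step.
  have := unimodular (true :: L)
  exact (coprime_of_unimodular this).2

/-- The lists of steps whose first step goes to the left. -/
inductive Proper : List Bool → Prop
  | nil : Proper []
  | one : Proper [true]
  | cons {s : Bool} {L : List Bool} (t : Bool) (h : Proper (s :: L)) : Proper (t :: s :: L)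

/-- The tree starts between `0/1` and the formal fraction `1/0`; a first step to the left replaces
`1/0` with `1/1`. -/
theorem Proper.hi_pos {L : List Bool} (h : Proper L) (hL : L ≠ []) :
    0 < (hi L).2 ∧ (hi L).1 ≤ (hi L).2 ∧ (lo L).1 < (lo L).2 := by
  induction h with
  | nil => exact absurd rfl hL
  | one => simp [lo, hi, basis]
  | cons t h ih =>
    have := ih (by simp)
    cases t <;> simp only [lo, hi, basis, Prod.fst_add, Prod.snd_add] at this ⊢ <;> omega

theorem Proper.med_lt {L : List Bool} (h : Proper L) (hL : L ≠ []) : (med L).1 < (med L).2 := by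
  have := h.hi_pos hL
  simp only [med, Prod.fst_add, Prod.snd_add]
  omega

theorem lo_lt_med (L : List Bool) : frac (lo L) < frac (med L) := by
  rw [frac_lt_frac (lo_pos L) (med_pos L)]
  have := unimodular L
  simp only [med, Prod.fst_add, Prod.snd_add]
  nlinarith

theorem med_lt_hi {L : List Bool} (h : 0 < (hi L).2) : frac (med L) < frac (hi L) := by
  rw [frac_lt_frac (med_pos L) h]
  have := unimodular L
  simp only [med, Prod.fst_add, Prod.snd_add]
  nlinarith

/-- A fraction strictly between two neighbors has a large denominator. -/
theorem le_of_between {L : List Bool} {m n : ℕ} (h₁ : (lo L).1 * n < m * (lo L).2)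
    (h₂ : m * (hi L).2 < (hi L).1 * n) : (med L).2 ≤ n := by
  have := unimodular L
  simp only [med, Prod.snd_add]
  zify at *
  -- Unimodularity expresses `n` through the two denominators, with coefficients that are positive
  -- integers by strict betweenness.
  have e : (n : ℤ) = ((hi L).1 * n - m * (hi L).2) * (lo L).2 +
      (m * (lo L).2 - (lo L).1 * n) * (hi L).2 := by linear_combination (-(n : ℤ)) * this
  have h3 : (1 : ℤ) ≤ (hi L).1 * n - m * (hi L).2 := by linarith
  have h4 : (1 : ℤ) ≤ m * (lo L).2 - (lo L).1 * n := by linarith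
  nlinarith [mul_nonneg (sub_nonneg.2 h3) (Int.natCast_nonneg (lo L).2),
    mul_nonneg (sub_nonneg.2 h4) (Int.natCast_nonneg (hi L).2)]

theorem med_true (L : List Bool) : med (true :: L) = med L + lo L := add_comm _ _

theorem med_false (L : List Bool) : med (false :: L) = med L + hi L := rfl

/-- The neighbors of a node in the first Farey sequence that contains it. -/
theorem Proper.before_fareySeq {L : List Bool} (h : Proper L) (hL : L ≠ []) :
    before (fareySeq (med L).2) (frac (med L)) = frac (lo L) := by
  have hp := h.hi_pos hL
  refine before_eq (pairwise_fareySeq _) (mem_fareySeq.2 ⟨_, _, hp.2.2.le, lo_pos L,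
    Nat.le_add_right _ _, rfl⟩) (lo_lt_med L) ?_
  intro x hx hxm
  obtain ⟨a, b, hab, hb, hbn, rfl⟩ := mem_fareySeq.1 hx
  by_contra! hlt
  have h1 := (frac_lt_frac (p := lo L) (r := (a, b)) (lo_pos L) hb).1 hlt
  have h2 := (frac_lt_frac (p := (a, b)) (r := med L) hb (med_pos L)).1 hxm
  -- The neighbors of `true :: L` are `lo L` and `med L`; a fraction between them has too large a
  -- denominator for this Farey sequence.
  have := le_of_between (L := true :: L) h1 h2
  rw [med_true, Prod.snd_add] at this
  have := lo_pos L
  omega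

theorem Proper.after_fareySeq {L : List Bool} (h : Proper L) (hL : L ≠ []) :
    after (fareySeq (med L).2) (frac (med L)) = frac (hi L) := by
  have hp := h.hi_pos hL
  refine after_eq (pairwise_fareySeq _) (mem_fareySeq.2 ⟨_, _, hp.2.1, hp.1,
    Nat.le_add_left _ _, rfl⟩) (med_lt_hi hp.1) ?_
  intro x hx hxm
  obtain ⟨a, b, hab, hb, hbn, rfl⟩ := mem_fareySeq.1 hx
  by_contra! hlt
  have h1 := (frac_lt_frac (p := (a, b)) (r := hi L) hb hp.1).1 hlt
  have h2 := (frac_lt_frac (p := med L) (r := (a, b)) (med_pos L) hb).1 hxm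
  have := le_of_between (L := false :: L) h2 h1
  rw [med_false, Prod.snd_add] at this
  omega

/-! ### The Farey plan -/

/-- The nodes on the path to a node, as fractions, last one first. -/
def fracs : List Bool → List ℚ
  | [] => [frac (med [])]
  | t :: L => frac (med (t :: L)) :: fracs L

theorem fracs_eq (L : List Bool) : fracs L = frac (med L) :: (fracs L).tail := by
  cases L <;> rfl

/-- Loop invariant: in `X` only `med L` lies strictly between its two tree neighbors, and `f` lies
strictly between them too. The clauses on `hi` are void at the root, where `hi` is `1/0`. The tail
of `fracs L` is what was recorded before, as `med L` is still to be recorded. -/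
theorem fareyLoop_eq {f : ℚ} (hf : f ≤ 1) (n : ℕ) : ∀ (L : List Bool) (X : List ℚ), Proper L →
    X.Pairwise (· ≤ ·) → frac (lo L) ∈ X → frac (med L) ∈ X → (L ≠ [] → frac (hi L) ∈ X) →
    (∀ x ∈ X, x ≤ frac (lo L) ∨ x = frac (med L) ∨ (L ≠ [] ∧ frac (hi L) ≤ x)) →
    frac (lo L) < f → (L ≠ [] → f < frac (hi L)) → f.den < n + (med L).2 →
    ∃ L', Proper L' ∧ frac (med L') = f ∧
      (fareyLoop f n X (frac (med L))).reverse ++ (fracs L).tail = fracs L' := by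
  induction n with
  | zero =>
    -- The iterations cannot run out: betweenness bounds the denominator of `med L` by that of `f`.
    intro L X hL hX h1 h2 h3 h4 h5 h6 h7
    exfalso
    have hden : (0 : ℕ) < f.den := f.den_pos
    rcases eq_or_ne L [] with rfl | hne
    · have : (med []).2 = 1 := rfl
      omega
    · have hf0 : 0 < f := lt_of_le_of_lt (by unfold frac; positivity) h5
      have hfe : f = frac (f.num.toNat, f.den) := by
        have h8 : ((f.num.toNat : ℕ) : ℤ) = f.num := Int.toNat_of_nonneg (Rat.num_pos.2 hf0).le
        have h9 : ((f.num.toNat : ℕ) : ℚ) = f.num := by exact_mod_cast congrArg (Int.cast (R := ℚ)) h8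
        rw [frac, h9, Rat.num_div_den]
      have h6 := h6 hne
      rw [hfe, frac_lt_frac (lo_pos L) hden] at h5
      rw [hfe, frac_lt_frac hden (hL.hi_pos hne).1] at h6
      have := le_of_between h5 h6
      omega
  | succ n ih =>
    intro L X hL hX h1 h2 h3 h4 h5 h6 h7
    have hlm := lo_lt_med L
    have hmh : L ≠ [] → frac (med L) < frac (hi L) := fun h => med_lt_hi (hL.hi_pos h).1
    rw [fareyLoop]
    split_ifs with hd hlt
    · exact ⟨L, hL, hd, (fracs_eq L).symm⟩
    -- The first step cannot go right, since `f ≤ 1`.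
    · have hne : L ≠ [] := by
        rintro rfl
        have : frac (med []) = 1 := by norm_num [frac, med, lo, hi, basis]
        rw [this] at hlt
        exact absurd hf (not_le.2 hlt)
      have ha : after X (frac (med L)) = frac (hi L) := by
        refine after_eq hX (h3 hne) (hmh hne) fun x hx hxm => ?_
        rcases h4 x hx with h | h | h
        · exact absurd (hxm.trans_le h) (not_lt.2 hlm.le)
        · exact absurd h hxm.ne'
        · exact h.2
      rw [ha, mediant_frac (med_pos L) (coprime_med L) (hL.hi_pos hne).1 (coprime_hi L),
        ← med_false]
      have hL' : Proper (false :: L) := by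
        cases L with
        | nil => exact absurd rfl hne
        | cons s L => exact hL.cons false
      have hnew := lo_lt_med (false :: L)
      have hnew' := med_lt_hi (L := false :: L) (hL.hi_pos hne).1
      obtain ⟨L', g1, g2, g3⟩ := ih (false :: L)
        (X.orderedInsert (· ≤ ·) (frac (med (false :: L)))) hL'
        (hX.orderedInsert _ _) (by simp only [List.mem_orderedInsert]; exact Or.inr h2)
        (by simp) (fun _ => by simp only [List.mem_orderedInsert]; exact Or.inr (h3 hne))
        (fun x hx => by
          rcases (List.mem_orderedInsert _).1 hx with rfl | hx
          · exact Or.inr (Or.inl rfl)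
          · rcases h4 x hx with h | h | h
            · exact Or.inl (h.trans hlm.le)
            · exact Or.inl h.le
            · exact Or.inr (Or.inr ⟨by simp, h.2⟩))
        hlt (fun _ => h6 hne) (by
          rw [med_false, Prod.snd_add]
          have := (hL.hi_pos hne).1
          omega)
      refine ⟨L', g1, g2, ?_⟩
      rw [List.reverse_cons, List.append_assoc, ← g3]
      congr 1
      exact (fracs_eq L).symm
    · have hlt' : f < frac (med L) := lt_of_le_of_ne (not_lt.1 hlt) (Ne.symm hd)
      have hb : before X (frac (med L)) = frac (lo L) := by
        refine before_eq hX h1 hlm fun x hx hxm => ?_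
        rcases h4 x hx with h | h | h
        · exact h
        · exact absurd h hxm.ne
        · exact absurd ((hmh h.1).trans_le h.2) (not_lt.2 hxm.le)
      rw [hb, mediant_frac (med_pos L) (coprime_med L) (lo_pos L) (coprime_lo L), ← med_true]
      have hL' : Proper (true :: L) := by
        cases L with
        | nil => exact .one
        | cons s L => exact hL.cons true
      obtain ⟨L', g1, g2, g3⟩ := ih (true :: L)
        (X.orderedInsert (· ≤ ·) (frac (med (true :: L)))) hL'
        (hX.orderedInsert _ _) (by simp only [List.mem_orderedInsert]; exact Or.inr h1)
        (by simp) (fun _ => by simp only [List.mem_orderedInsert]; exact Or.inr h2)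
        (fun x hx => by
          rcases (List.mem_orderedInsert _).1 hx with rfl | hx
          · exact Or.inr (Or.inl rfl)
          · rcases h4 x hx with h | h | h
            · exact Or.inl h
            · exact Or.inr (Or.inr ⟨by simp, h.ge⟩)
            · exact Or.inr (Or.inr ⟨by simp, (hmh h.1).le.trans h.2⟩))
        h5 (fun _ => hlt') (by
          rw [med_true, Prod.snd_add]
          have := lo_pos L
          omega)
      refine ⟨L', g1, g2, ?_⟩
      rw [List.reverse_cons, List.append_assoc, ← g3]
      congr 1
      exact (fracs_eq L).symm

theorem exists_fareyLoop {f : ℚ} (hf0 : 0 < f) (hf : f ≤ 1) :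
    ∃ L, Proper L ∧ frac (med L) = f ∧ (fareyLoop f f.den (fareySeq 1) 1).reverse = fracs L := by
  have hmed : frac (med []) = 1 := by norm_num [frac, med, lo, hi, basis]
  have hlo : frac (lo []) = 0 := by norm_num [frac, lo, basis]
  obtain ⟨L, h1, h2, h3⟩ := fareyLoop_eq hf f.den [] (fareySeq 1) .nil (pairwise_fareySeq 1)
    (mem_fareySeq.2 ⟨0, 1, by norm_num, le_rfl, le_rfl, by rw [hlo]; norm_num⟩)
    (mem_fareySeq.2 ⟨1, 1, by norm_num, le_rfl, le_rfl, by rw [hmed]; norm_num⟩)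
    (by simp)
    (fun x hx => by
      obtain ⟨a, b, hab, hb, hb', rfl⟩ := mem_fareySeq.1 hx
      obtain rfl : b = 1 := le_antisymm hb' hb
      rw [hlo, hmed]
      interval_cases a <;> norm_num)
    (by rwa [hlo]) (by simp) (Nat.lt_succ_self _)
  rw [hmed] at h3
  exact ⟨L, h1, h2, by simpa [fracs] using h3⟩

/-! ### Edges in a frame -/

/-- The two unit vectors of the defining pair of `e`, the one of the larger coordinate first. -/
def Edge.frame (e : Edge) : Pt × Pt :=
  if e.x < e.y then (unitVec (e.pair + 1 : ℕ), unitVec e.pair)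
  else (unitVec e.pair, unitVec (e.pair + 1 : ℕ))

/-- The two coordinates of `e`, the larger one last. -/
def Edge.coords (e : Edge) : ℕ × ℕ := if e.x < e.y then (e.x, e.y) else (e.y, e.x)

/-- The lattice vector with given coordinates in a frame. -/
def ofCoords (F : Pt × Pt) : ℕ × ℕ →+ Pt where
  toFun p := p.1 • F.2 + p.2 • F.1
  map_zero' := by simp
  map_add' p r := by simp only [Prod.fst_add, Prod.snd_add, add_smul]; abel

/-- The additive map `ofCoords F` sends the starting pairs `(0, 1)` and `(1, 0)` to `F.1` and `F.2`,
so it matches the two trees. -/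
theorem ofCoords_lo (F : Pt × Pt) (L : List Bool) : ofCoords F (lo L) = (basis F.1 F.2 L).1 := by
  have := map_basis (ofCoords F) (0, 1) (1, 0) L
  simp only [ofCoords, AddMonoidHom.coe_mk, ZeroHom.coe_mk, zero_smul, one_smul, zero_add,
    add_zero] at this
  rw [this]
  rfl

theorem ofCoords_hi (F : Pt × Pt) (L : List Bool) : ofCoords F (hi L) = (basis F.1 F.2 L).2 := by
  have := map_basis (ofCoords F) (0, 1) (1, 0) L
  simp only [ofCoords, AddMonoidHom.coe_mk, ZeroHom.coe_mk, zero_smul, one_smul, zero_add,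
    add_zero] at this
  rw [this]
  rfl

theorem ofCoords_med (F : Pt × Pt) (L : List Bool) : ofCoords F (med L) = tip F.1 F.2 L := by
  rw [med, map_add, ofCoords_lo, ofCoords_hi, tip]

theorem Edge.vec_eq (e : Edge) : e.vec = ofCoords e.frame e.coords := by
  simp only [Edge.vec, ofCoords, Edge.frame, Edge.coords, AddMonoidHom.coe_mk, ZeroHom.coe_mk]
  split_ifs <;> simp [add_comm]

theorem Edge.phi_eq (e : Edge) : e.phi = frac e.coords := by
  simp only [Edge.phi, frac, Edge.coords]
  split_ifs <;> rfl

theorem isUnitFrame_unitVec (k : ℕ) : IsUnitFrame (unitVec k) (unitVec (k + 1)) := by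
  have h : ∀ k, sqNorm (unitVec k) = 1 := by
    intro k
    induction k with
    | zero => rfl
    | succ k ih => rw [unitVec, Function.iterate_succ_apply', sqNorm_rot]; exact ih
  exact Or.inl ⟨h k, Function.iterate_succ_apply' _ _ _⟩

theorem IsUnitFrame.symm {P Q : Pt} (h : IsUnitFrame P Q) : IsUnitFrame Q P := Or.symm h

theorem Edge.isUnitFrame (e : Edge) : IsUnitFrame e.frame.1 e.frame.2 := by
  rw [Edge.frame]
  split_ifs
  · exact (isUnitFrame_unitVec _).symm
  · exact isUnitFrame_unitVec _

theorem Edge.coords_coprime (e : Edge) : e.coords.1.Coprime e.coords.2 := by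
  rw [Edge.coords]
  split_ifs
  · exact e.coprime
  · exact e.coprime.symm

theorem eq_of_frac_eq {p r : ℕ × ℕ} (hp : 0 < p.2) (hp' : p.1.Coprime p.2) (hr : 0 < r.2)
    (hr' : r.1.Coprime r.2) (h : frac p = frac r) : p = r := by
  refine Prod.ext ?_ ?_
  · have h1 := num_frac hp hp'
    rw [h, num_frac hr hr'] at h1
    exact_mod_cast h1.symm
  · rw [← den_frac hp hp', h, den_frac hr hr']

theorem Edge.phiInv_xy (e : Edge) {p : ℕ × ℕ} (hp : 0 < p.2) (hp' : p.1.Coprime p.2) :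
    (e.phiInv (frac p)).pair = e.pair ∧ (e.phiInv (frac p)).x = (if e.x < e.y then p.1 else p.2) ∧
      (e.phiInv (frac p)).y = (if e.x < e.y then p.2 else p.1) := by
  rw [Edge.phiInv]
  split_ifs <;> simp [num_frac hp hp', den_frac hp hp']

theorem Edge.phiInv_vec (e : Edge) {p : ℕ × ℕ} (hp : 0 < p.2) (hp' : p.1.Coprime p.2) :
    (e.phiInv (frac p)).vec = ofCoords e.frame p := by
  obtain ⟨h1, h2, h3⟩ := e.phiInv_xy hp hp'
  rw [Edge.vec, h1, h2, h3, Edge.frame]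
  split_ifs <;> simp [ofCoords, add_comm]

theorem Edge.phiInv_sqLength (e : Edge) {p : ℕ × ℕ} (hp : 0 < p.2) (hp' : p.1.Coprime p.2) :
    (e.phiInv (frac p)).sqLength = p.1 ^ 2 + p.1 * p.2 + p.2 ^ 2 := by
  obtain ⟨h1, h2, h3⟩ := e.phiInv_xy hp hp'
  rw [Edge.sqLength, h2, h3]
  split_ifs
  · rfl
  · ring

theorem Edge.phiInv_frame (e : Edge) {p : ℕ × ℕ} (hp' : p.1.Coprime p.2) (hlt : p.1 < p.2) :
    (e.phiInv (frac p)).frame = e.frame ∧ (e.phiInv (frac p)).coords = p := by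
  obtain ⟨h1, h2, h3⟩ := e.phiInv_xy (by omega) hp'
  rw [Edge.frame, Edge.coords, h1, h2, h3, Edge.frame]
  by_cases h : e.x < e.y
  · simp [h, hlt]
  · simp [h, not_lt.2 hlt.le]

/-! ### Edges as nodes of the tree -/

/-- `P`, `Q` is the frame of `e`, or the exchanged frame if both coordinates of `e` are `1`, and `e`
is the mediant of the basis reached by `L`. -/
structure Edge.IsTip (e : Edge) (P Q : Pt) (L : List Bool) : Prop where
  coords : e.coords = med L
  frame : e.frame = (P, Q) ∨ L = [] ∧ e.frame = (Q, P)

theorem Edge.IsTip.xy_one {e : Edge} {P Q : Pt} (h : e.IsTip P Q []) : e.x = 1 ∧ e.y = 1 := by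
  have h1 := h.coords
  have h2 : med [] = (1, 1) := rfl
  rw [h2, Edge.coords] at h1
  split_ifs at h1 <;> simp only [Prod.mk.injEq] at h1 <;> omega

theorem Edge.IsTip.frame_nil {e : Edge} {P Q : Pt} (h : e.IsTip P Q []) :
    (unitVec e.pair, unitVec (e.pair + 1 : ℕ)) = (P, Q) ∨
      (unitVec e.pair, unitVec (e.pair + 1 : ℕ)) = (Q, P) := by
  have h1 := h.xy_one
  have h2 := h.frame
  rw [Edge.frame, if_neg (by omega)] at h2
  exact h2.imp id And.right

theorem Edge.IsTip.vec {e : Edge} {P Q : Pt} {L : List Bool} (h : e.IsTip P Q L) :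
    e.vec = tip P Q L := by
  rw [Edge.vec_eq, h.coords]
  rcases h.frame with h1 | ⟨rfl, h1⟩
  · rw [h1, ofCoords_med]
  · rw [h1, ofCoords_med]
    exact add_comm _ _

theorem Edge.IsTip.neighbors_cons {e : Edge} {P Q : Pt} {L : List Bool} (h : e.IsTip P Q L)
    (hL : Proper L) (hne : L ≠ []) :
    e.neighbors = (e.phiInv (frac (lo L)), e.phiInv (frac (hi L))) := by
  have h1 : ¬ (e.x = 1 ∧ e.y = 1) := by
    intro h1
    have h2 := hL.med_lt hne
    rw [← h.coords, Edge.coords, if_neg (by omega)] at h2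
    simp only at h2
    omega
  rw [Edge.neighbors, if_neg h1, Edge.phi_eq, h.coords, den_frac (med_pos L) (coprime_med L),
    hL.before_fareySeq hne, hL.after_fareySeq hne]

/-- Only at the edge `(1, 1)` can the order of the two sides be exchanged; flips and halves do not
depend on it. -/
theorem Edge.IsTip.neighbors_vec {e : Edge} {P Q : Pt} {L : List Bool} (h : e.IsTip P Q L)
    (hL : Proper L) :
    (e.neighbors.1.vec = (basis P Q L).1 ∧ e.neighbors.2.vec = (basis P Q L).2) ∨
      (e.neighbors.1.vec = (basis P Q L).2 ∧ e.neighbors.2.vec = (basis P Q L).1) := by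
  by_cases hne : L = []
  · subst hne
    rw [Edge.neighbors, if_pos h.xy_one]
    simp only [Edge.vec, Nat.cast_zero, Nat.cast_one, zero_smul, one_smul, zero_add, add_zero,
      basis]
    rcases h.frame_nil with h1 | h1 <;> simp only [Prod.mk.injEq] at h1
    · exact Or.inr ⟨h1.2, h1.1⟩
    · exact Or.inl ⟨h1.2, h1.1⟩
  · have hf : e.frame = (P, Q) := h.frame.resolve_right fun h => hne h.1
    rw [h.neighbors_cons hL hne]
    exact Or.inl ⟨by rw [e.phiInv_vec (lo_pos L) (coprime_lo L), hf, ofCoords_lo],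
      by rw [e.phiInv_vec (hL.hi_pos hne).1 (coprime_hi L), hf, ofCoords_hi]⟩

theorem Edge.IsTip.flip {e : Edge} {P Q : Pt} {L : List Bool} (h : e.IsTip P Q L)
    (hL : Proper L) (v : Pt) : e.flip v = pflip P Q L v := by
  rw [Edge.flip, Edge.at, pflip, h.vec]
  rcases h.neighbors_vec hL with h1 | h1
  · rw [h1.1, h1.2]
  · rw [h1.1, h1.2, Sym2.eq_swap]

/-- The last step keeps the pivot and replaces the other basis vector with a sum that contains the
pivot, hence with a longer one. -/
theorem Edge.IsTip.shorterNeighbor {e : Edge} {P Q : Pt} {t : Bool} {L : List Bool}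
    (h : e.IsTip P Q (t :: L)) (hL : Proper (t :: L)) :
    e.shorterNeighbor.vec = pivot P Q t L := by
  have hf : e.frame = (P, Q) := h.frame.resolve_right (by simp)
  have hp := hL.hi_pos (by simp)
  rw [Edge.shorterNeighbor, h.neighbors_cons hL (by simp),
    e.phiInv_sqLength (lo_pos _) (coprime_lo _), e.phiInv_sqLength hp.1 (coprime_hi _)]
  cases t
  -- Ties select the first neighbor, so here the comparison must be strict; it is because the
  -- denominator of `lo L` is positive.
  · rw [if_neg, e.phiInv_vec hp.1 (coprime_hi _), hf, ofCoords_hi]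
    · rfl
    · have h1 : lo (false :: L) = lo L + hi (false :: L) := rfl
      have h2 := lo_pos L
      rw [h1, Prod.fst_add, Prod.snd_add, not_le]
      nlinarith [Nat.zero_le ((lo L).1 * (lo L).2), Nat.zero_le ((lo L).1 * (hi (false :: L)).2),
        Nat.zero_le ((hi (false :: L)).1 * (lo L).2),
        Nat.zero_le ((hi (false :: L)).1 * (lo L).1), Nat.zero_le ((lo L).1 ^ 2)]
  · rw [if_pos, e.phiInv_vec (lo_pos _) (coprime_lo _), hf, ofCoords_lo]
    · rfl
    · have h1 : hi (true :: L) = lo (true :: L) + hi L := rfl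
      rw [h1, Prod.fst_add, Prod.snd_add]
      gcongr <;> omega

theorem Proper.tail {t : Bool} {L : List Bool} (h : Proper (t :: L)) : Proper L := by
  cases h with
  | one => exact .nil
  | cons _ h => exact h

/-- The order of the coordinates survives until the descent reaches `(1, 1)`. There it is lost, and
the frame of the new edge may be the exchanged one. -/
theorem Edge.IsTip.parent {e : Edge} {P Q : Pt} {t : Bool} {L : List Bool}
    (h : e.IsTip P Q (t :: L)) (hL : Proper (t :: L)) :
    (e.phiInv (frac (med L))).IsTip P Q L := by
  have hf : e.frame = (P, Q) := h.frame.resolve_right (by simp)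
  by_cases hne : L = []
  · subst hne
    obtain ⟨h1, h2, h3⟩ := e.phiInv_xy (med_pos []) (coprime_med [])
    have hm : med [] = (1, 1) := rfl
    rw [hm] at h1 h2 h3 ⊢
    simp only [ite_self] at h2 h3
    constructor
    · rw [Edge.coords, h2, h3]
      rfl
    · rw [Edge.frame] at hf
      rw [Edge.frame, h1, h2, h3]
      split_ifs at hf with h4
      · simp only [Prod.mk.injEq] at hf
        exact Or.inr ⟨rfl, by simp [hf.1, hf.2]⟩
      · exact Or.inl (by simpa using hf)
  · obtain ⟨h1, h2⟩ := e.phiInv_frame (coprime_med L) (hL.tail.med_lt hne)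
    exact ⟨h2, Or.inl (h1.trans hf)⟩

theorem Edge.IsTip.flipPlanAux {P Q : Pt} {L : List Bool} (hL : Proper L) :
    ∀ {e : Edge}, e.IsTip P Q L → ∀ v, flipPlanAux (fracs L) e v = plan P Q L v := by
  induction L with
  | nil =>
    intro e h v
    simp only [fracs, FareyFlip.flipPlanAux, plan, h.flip hL]
  | cons t L ih =>
    intro e h v
    have h1 := h.parent hL
    -- Exposing the head of `fracs L` selects the recursive branch, with `med L` as the fraction of
    -- the longer side.
    rw [fracs, fracs_eq L, FareyFlip.flipPlanAux]
    rw [← fracs_eq L, ih hL.tail h1, ih hL.tail h1, h.shorterNeighbor hL, h.flip hL,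
      h1.flip hL.tail, h1.flip hL.tail]
    rfl

theorem Edge.coords_pos (e : Edge) (h : ¬ ((e.x = 0 ∧ e.y = 1) ∨ (e.x = 1 ∧ e.y = 0))) :
    0 < e.coords.1 ∧ e.coords.1 ≤ e.coords.2 := by
  have h1 : e.x ≠ 0 := fun h1 => h (Or.inl ⟨h1, by simpa [h1] using e.coprime⟩)
  have h2 : e.y ≠ 0 := fun h2 => h (Or.inr ⟨by simpa [h2] using e.coprime, h2⟩)
  rw [Edge.coords]
  split_ifs <;> simp only <;> omega

/-- The output of Algorithm Flip Plan in terms of the Stern–Brocot tree. -/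
theorem Edge.exists_flipPlan_eq (e : Edge)
    (h : ¬ ((e.x = 0 ∧ e.y = 1) ∨ (e.x = 1 ∧ e.y = 0))) :
    ∃ P Q L, IsUnitFrame P Q ∧ Proper L ∧ e.IsTip P Q L ∧ ∀ v, e.flipPlan v = plan P Q L v := by
  have hp := e.coords_pos h
  have hp2 : 0 < e.coords.2 := by omega
  obtain ⟨L, h1, h2, h3⟩ := exists_fareyLoop (f := e.phi)
    (by rw [Edge.phi_eq, frac]; have := hp.1; positivity)
    (by
      rw [Edge.phi_eq, frac, div_le_one (by exact_mod_cast hp2)]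
      exact_mod_cast hp.2)
  have ht : e.IsTip e.frame.1 e.frame.2 L := by
    rw [Edge.phi_eq] at h2
    exact ⟨(eq_of_frac_eq (med_pos L) (coprime_med L) hp2 e.coords_coprime h2).symm, Or.inl rfl⟩
  refine ⟨e.frame.1, e.frame.2, L, e.isUnitFrame, h1, ht, fun v => ?_⟩
  rw [Edge.flipPlan, Edge.fareyPlan, if_neg h, h3, ht.flipPlanAux h1]

/-! ### Generated edges and adjacent copies -/

theorem Edge.IsTip.halves {e : Edge} {P Q : Pt} {L : List Bool} (h : e.IsTip P Q L)
    (hL : Proper L) (v : Pt) (i : Bool) : out P Q L v i ∈ e.halves v := by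
  rw [Edge.halves, h.vec]
  rcases h.neighbors_vec hL with h1 | h1 <;> rw [h1.1, h1.2] <;> cases i <;> simp [out]

/-- Turns a side shared by two root parallelograms into an edge shared by two created halves. -/
theorem Edge.IsTip.sides {e : Edge} {P Q : Pt} {L : List Bool} (h : e.IsTip P Q L)
    (hF : IsFrame P Q) (hL : Proper L) {v : Pt} {σ : Sym2 Pt} (hσ : σ ∈ e.sides v) :
    ∃ i a b, a ≠ b ∧ σ = s(a, b) ∧ a ∈ out P Q L v i ∧ b ∈ out P Q L v i := by
  have hA : v ≠ v + (basis P Q L).1 := fun h1 => by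
    have h2 := (hF.height_basis_pos L).1
    rw [left_eq_add.1 h1] at h2
    simp [height, cr] at h2
  have hB : v ≠ v + (basis P Q L).2 := fun h1 => by
    have h2 := (hF.height_basis_pos L).2
    rw [left_eq_add.1 h1] at h2
    simp [height, cr] at h2
  have hA' : v + (basis P Q L).2 ≠ v + tip P Q L := fun h1 => by
    refine hA ?_
    rw [tip, add_comm (basis P Q L).1, ← add_assoc, left_eq_add] at h1
    rw [h1, add_zero]
  have hB' : v + (basis P Q L).1 ≠ v + tip P Q L := fun h1 => by
    refine hB ?_
    rw [tip, ← add_assoc, left_eq_add] at h1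
    rw [h1, add_zero]
  have key : σ = s(v, v + (basis P Q L).1) ∨ σ = s(v, v + (basis P Q L).2) ∨
      σ = s(v + (basis P Q L).1, v + tip P Q L) ∨ σ = s(v + (basis P Q L).2, v + tip P Q L) := by
    rw [Edge.sides, h.vec] at hσ
    simp only [Finset.mem_insert, Finset.mem_singleton] at hσ
    rcases h.neighbors_vec hL with h1 | h1 <;> rw [h1.1, h1.2] at hσ <;> tauto
  rcases key with rfl | rfl | rfl | rfl
  · exact ⟨true, _, _, hA, rfl, by simp [out], by simp [out]⟩
  · exact ⟨false, _, _, hB, rfl, by simp [out], by simp [out]⟩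
  · exact ⟨true, _, _, hB', rfl, by simp [out], by simp [out]⟩
  · exact ⟨false, _, _, hA', rfl, by simp [out], by simp [out]⟩

/-- Three common vertices would make the triangles equal, and then `out_eq` would give `u = v`. -/
theorem card_out_inter {P Q : Pt} (hF : IsFrame P Q) {L : List Bool} {u v : Pt} (huv : u ≠ v)
    {i j : Bool} {a b : Pt} (hab : a ≠ b) (ha : a ∈ out P Q L u i) (hb : b ∈ out P Q L u i)
    (ha' : a ∈ out P Q L v j) (hb' : b ∈ out P Q L v j) :
    (out P Q L u i ∩ out P Q L v j).card = 2 := by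
  have h3 : ∀ w k, (out P Q L w k).card ≤ 3 := by
    intro w k
    cases k <;> exact Finset.card_le_three
  refine le_antisymm ?_ ?_
  · by_contra! h
    have h1 := Finset.eq_of_subset_of_card_le (Finset.inter_subset_left)
      ((h3 u i).trans h)
    have h2 := Finset.eq_of_subset_of_card_le (Finset.inter_subset_right)
      ((h3 v j).trans h)
    exact huv (hF.out_eq _ _ (h1.symm.trans h2)).1
  · rw [← Finset.card_pair hab]
    refine Finset.card_le_card fun x hx => ?_
    rw [Finset.mem_insert, Finset.mem_singleton] at hx
    rcases hx with rfl | rfl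
    · exact Finset.mem_inter.2 ⟨ha, ha'⟩
    · exact Finset.mem_inter.2 ⟨hb, hb'⟩

theorem at_mem_edges {e : Edge} {P Q : Pt} {L : List Bool} (h : e.IsTip P Q L) (hF : IsFrame P Q)
    {v : Pt} {T : Set (Finset Pt)} (hT : out P Q L v true ∈ T) : e.at v ∈ edges T := by
  refine ⟨v, v + tip P Q L, fun h1 => ?_, by rw [Edge.at, h.vec], _, hT, by simp [out],
    by simp [out]⟩
  have h2 := hF.height_tip L
  rw [left_eq_add.1 h1] at h2
  simp [height, cr] at h2

/-- The flip plan of a unit edge. -/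
theorem isFlipPlan_unit {Ω : Set ℂ} {T : Set (Finset Pt)} (hT : IsEquilateralTriangulation Ω T)
    {e : Edge} (h : (e.x = 0 ∧ e.y = 1) ∨ (e.x = 1 ∧ e.y = 0)) {v : Pt} (hseg : e.seg v ⊆ Ω) :
    IsFlipPlan (e.flipPlan v) T {e.at v} := by
  have hplan : e.flipPlan v = ⟨∅, ∅⟩ := by
    rw [Edge.flipPlan, Edge.fareyPlan, if_pos h]
    rfl
  have hedge : e.at v ∈ edges T := by
    have hU := isUnitFrame_unitVec e.pair
    rcases h with h | h
    · have hv : e.vec = unitVec (e.pair + 1 : ℕ) := by rw [Edge.vec, h.1, h.2]; simp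
      rw [Edge.seg, hv] at hseg
      rw [Edge.at, hv]
      exact hT.mem_edges_of_unit hU.symm hseg
    · have hv : e.vec = unitVec e.pair := by rw [Edge.vec, h.1, h.2]; simp
      rw [Edge.seg, hv] at hseg
      rw [Edge.at, hv]
      exact hT.mem_edges_of_unit hU hseg
  have hM : (⟨∅, ∅⟩ : FlipPoset).IsMarkedGraph T (fun _ => 0) := by
    constructor <;> simp
  rw [hplan]
  refine hM.isFlipPlan fun l T' hl hp => ?_
  have hnil : l = [] := List.eq_nil_iff_forall_not_mem.2 fun s hs => by simpa using (hl.2.1 s).1 hs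
  subst hnil
  cases hp
  simpa using hedge

end FareyFlip

/-! ### The theorem -/

open FareyFlip in
theorem mainTheorem4 (Ω : Set ℂ) (T : Set (Finset Pt)) (hT : IsEquilateralTriangulation Ω T)
    (e : Edge) :
    (∀ u v : Pt, AdjacentPlans e u v → e.seg u ⊆ Ω → e.seg v ⊆ Ω →
      IsFlipPlan ((e.flipPlan u).union (e.flipPlan v)) T {e.at u, e.at v} ∧
      ∀ (l : List Flip) (T' : Set (Finset Pt)),
        ((e.flipPlan u).union (e.flipPlan v)).IsLinearOrdering l → FlipPath T l T' →
        AdjacentCopies T' e u v) ∧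
    (∀ v : Pt, e.seg v ⊆ Ω → IsFlipPlan (e.flipPlan v) T {e.at v}) := by
  by_cases hunit : (e.x = 0 ∧ e.y = 1) ∨ (e.x = 1 ∧ e.y = 0)
  · refine ⟨fun u v h => absurd ?_ h.1, fun v hv => isFlipPlan_unit hT hunit hv⟩
    rw [Edge.fareyPlan, if_pos hunit]
  obtain ⟨P, Q, L, hU, hL, htip, hplan⟩ := e.exists_flipPlan_eq hunit
  have hF := hU.isFrame
  have hTh : ∀ t ∈ T, ∀ a ∈ t, ∀ b ∈ t, height P Q a ≤ height P Q b + 1 :=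
    fun t ht a ha b hb => hT.height_le hU ht ha hb
  have hbase : ∀ v, e.seg v ⊆ Ω → ∀ u i, Node P Q L v [] u → inp P Q [] u i ∈ T := by
    intro v hv u i hn
    rw [Edge.seg, htip.vec] at hv
    exact hT.inp_mem_of_node hU hv hn i
  constructor
  · intro u v hadj hu hv
    rw [hplan, hplan]
    -- Both plans follow the same branch `L`, so the union is again a node set on one branch;
    -- adjacency is needed only for the shared edge at the end.
    have hD := (hasNodes_plan P Q L u).union (hasNodes_plan P Q L v)
    have hsuf : ∀ L' w, Node P Q L u L' w ∨ Node P Q L v L' w → L' <:+ L :=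
      fun _ _ h => h.elim Node.suffix Node.suffix
    have hM := hF.isMarkedGraph hTh hD hsuf (fun _ _ _ h => h.imp Node.left Node.left)
      (fun _ _ _ h => h.imp Node.right Node.right)
      (fun w i h => h.elim (hbase u hu w i) (hbase v hv w i))
    have hou : ∀ l T', _ → FlipPath T l T' → ∀ i, out P Q L u i ∈ T' :=
      fun l T' hl hp => hF.out_mem hM hD hsuf (Or.inl .root) hl hp
    have hov : ∀ l T', _ → FlipPath T l T' → ∀ i, out P Q L v i ∈ T' :=
      fun l T' hl hp => hF.out_mem hM hD hsuf (Or.inr .root) hl hp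
    refine ⟨hM.isFlipPlan fun l T' hl hp => ?_, fun l T' hl hp => ?_⟩
    · rintro _ (rfl | rfl)
      · exact at_mem_edges htip hF (hou l T' hl hp true)
      · exact at_mem_edges htip hF (hov l T' hl hp true)
    · obtain ⟨-, huv, σ, hσ⟩ := hadj
      rw [Finset.mem_inter] at hσ
      obtain ⟨i, a, b, hab, rfl, ha, hb⟩ := htip.sides hF hL hσ.1
      obtain ⟨j, a', b', -, hab', ha', hb'⟩ := htip.sides hF hL hσ.2
      have h2 : a ∈ out P Q L v j ∧ b ∈ out P Q L v j := by
        rcases Sym2.eq_iff.1 hab' with ⟨rfl, rfl⟩ | ⟨rfl, rfl⟩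
        · exact ⟨ha', hb'⟩
        · exact ⟨hb', ha'⟩
      exact ⟨huv, at_mem_edges htip hF (hou l T' hl hp true),
        at_mem_edges htip hF (hov l T' hl hp true), _, htip.halves hL u i, _, htip.halves hL v j,
        hou l T' hl hp i, hov l T' hl hp j, card_out_inter hF huv hab ha hb h2.1 h2.2⟩
  · intro v hv
    rw [hplan]
    have hD := hasNodes_plan P Q L v
    have hM := hF.isMarkedGraph hTh hD (fun _ _ h => h.suffix) (fun _ _ _ h => h.left)
      (fun _ _ _ h => h.right) (hbase v hv)
    refine hM.isFlipPlan fun l T' hl hp => ?_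
    rintro _ rfl
    exact at_mem_edges htip hF
      (hF.out_mem hM hD (fun _ _ h => h.suffix) .root hl hp true)
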